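/- **Setting.** A composite problem is $\min_{x\in\mathbb R^n}F(x):=f(x)+h(Ax-b)$ with $f:\mathbb R^n\to\mathbb R$ differentiable, $h:\mathbb R^m\to(-\infty,+\infty]$ proper, closed and convex, $A\in\mathbb R^{m\times n}$ of full row rank, $b\in\mathbb R^m$. Call $f$ $L$-smooth if $\nabla f$ is $L$-Lipschitz in the Euclidean norm, put $\kappa(A)=\|A\|/\sigma_{\min}(A)$, and $\operatorname{prox}_\varphi(x)=\arg\min_u\{\varphi(u)+\tfrac12\|x-u\|^2\}$. For $L_f,\Delta>0$, $\kappa_A\ge1$, the class $\mathcal F_{\rm NC}(L_f,\kappa_A,\Delta)$ with initial point $x_0$ consists of the problems with $f$ $L_f$-smooth, $F(x_0)<\infty$, $F(x_0)-\inf_xF(x)\le\Delta$ and $\kappa(A)\le\kappa_A$. Put $$\operatorname{SubOpt}_{\rm NC}(x)=L_f\Big\|x-\operatorname{prox}_{\frac1{L_f}h(A\cdot-b)}\big(x-\tfrac1{2L_f}\nabla f(x)\big)\Big\|,$$ which for $h=\mathbb I_{\{0\}}$ (value $0$ at $0$, $+\infty$ elsewhere) is $L_f\|x-\mathcal P_{\{Ax=b\}}(x-\frac1{2L_f}\nabla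 f(x))\|$. A sequence $(x_k,\lambda_k)_{k\ge0}$ is generated by a *first-order linear-span algorithm* if $x_k\in\mathcal S^x_k$, $\lambda_k\in\mathcal S^\lambda_k$ for all $k$, where $\mathcal S^x_0=\mathrm{Span}\{x_0\}$, $\mathcal S^\lambda_0=\mathrm{Span}\{\lambda_0\}$ and $$\mathcal S^x_{k+1}=\mathrm{Span}\{x_i,\ \nabla f(\hat x),\ A^\top\hat\lambda:\ 0\le i\le k,\ \hat x\in\mathcal S^x_i,\ \hat\lambda\in\mathcal S^\lambda_i\},$$ $$\mathcal S^\lambda_{k+1}=\mathrm{Span}\{\lambda_i,\ \operatorname{prox}_{\eta h^\star}(\hat\lambda+\eta(A\hat x-b)):\ 0\le i\le k,\ 0\le j\le k+1,\ \hat\lambda\in\mathcal S^\lambda_i,\ \hat x\in\mathcal S^x_j,\ \eta>0\},$$ with $h^\star$ the convex conjugate of $h$. **Hard instance.** Let $\Psi(t)=0$ for $t\le\frac12$, $\Psi(t)=\exp\!\big(1-\frac1{(2t-1)^2}\big)$ for $t>\frac12$, $\Phi(t)=\sqrt e\int_{-\infty}^te^{-s^2/2}\,ds$, and for $u,v\in\mathbb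 R^d$ $$G_0(u,v)=-\Psi(1)\Phi(u_1)+\sum_{i=2}^d\big[\Psi(-v_{i-1})\Phi(-u_i)-\Psi(v_{i-1})\Phi(u_i)\big],\qquad G(u,v)=\frac{L_f\alpha^2}{l_0}\,G_0\Big(\frac u\alpha,\frac v\alpha\Big).$$ For $x=(x[1],\dots,x[2N])\in(\mathbb R^d)^{2N}$ let $P(N,d,\alpha)$ be the problem $$\min_x\ \sum_{i=1}^NG(x[i],x[N+i])\quad\text{s.t.}\quad x[1]=x[2]=\cdots=x[2N],$$ that is, $h=\mathbb I_{\{0\}}$, $b=0$ and $Ax=(x[i]-x[i+1])_{1\le i\le2N-1}$. **Theorem.** There are universal constants $l_0,c_0,c_1>0$ such that $G_0$ is $l_0$-smooth for every $d$ and the following hold for all $L_f,\Delta>0$ and $\kappa_A\ge1$. 1. For every integer $k\ge\kappa_A$, put $N=\lfloor\frac{\kappa_A+1}2\rfloor$, $K=\lfloor\frac{k-2}{N+1}\rfloor+1$, $d=K+2$, $\alpha=\sqrt{\frac{l_0\Delta}{12NdL_f}}$. The problem $P(N,d,\alpha)$ belongs to $\mathcal F_{\rm NC}(L_f,\kappa_A,\Delta)$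 with $x_0=0$, and on it the iterates of every first-order linear-span algorithm started at $x_0=0$, $\lambda_0=0$ satisfy $$\operatorname{SubOpt}_{\rm NC}(x_k)\ \ge\ c_0\sqrt{\frac{\kappa_AL_f\Delta}{k}}.$$ 2. For every $0<\epsilon\le c_0\sqrt{L_f\Delta}$ there are positive integers $N,d$ and $\alpha>0$ such that $P(N,d,\alpha)$ belongs to $\mathcal F_{\rm NC}(L_f,\kappa_A,\Delta)$ with $x_0=0$, and for every first-order linear-span algorithm started at $x_0=0$, $\lambda_0=0$ on it and every $k$, $\operatorname{SubOpt}_{\rm NC}(x_k)\le\epsilon$ implies $k\ge c_1\,\kappa_AL_f\Delta/\epsilon^2$. -/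

import Mathlib

open scoped Gradient

noncomputable section

/-- `f` is differentiable and its gradient is `L`-Lipschitz. -/
def IsSmoothWith {E : Type*} [NormedAddCommGroup E] [InnerProductSpace ℝ E] [CompleteSpace E]
    (L : ℝ) (f : E → ℝ) : Prop :=
  Differentiable ℝ f ∧ ∀ x y : E, ‖∇ f x - ∇ f y‖ ≤ L * ‖x - y‖

/-- Proper, closed and convex extended-real-valued functions. -/
structure IsProperClosedConvex {E : Type*} [NormedAddCommGroup E] [InnerProductSpace ℝ E]
    (h : E → EReal) : Prop where
  ne_bot : ∀ z, h z ≠ ⊥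
  exists_ne_top : ∃ z, h z ≠ ⊤
  closed : LowerSemicontinuous h
  convex : Convex ℝ {p : E × ℝ | h p.1 ≤ (p.2 : EReal)}

/-- The indicator function of a set: `0` on the set and `+∞` off it. -/
def setIndicator {E : Type*} (S : Set E) : E → EReal := by
  classical exact fun z => if z ∈ S then 0 else ⊤

/-- The convex conjugate `h⋆(y) = sup_z (⟨z, y⟩ - h(z))`. -/
def conjugate {E : Type*} [NormedAddCommGroup E] [InnerProductSpace ℝ E]
    (h : E → EReal) (y : E) : EReal :=
  ⨆ z : E, ((inner ℝ z y : ℝ) : EReal) - h z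

/-- `p` is a minimiser of `u ↦ h(u) + ‖x - u‖² / 2`. -/
def IsProxPoint {E : Type*} [NormedAddCommGroup E] [InnerProductSpace ℝ E]
    (h : E → EReal) (x p : E) : Prop :=
  IsMinOn (fun u => h u + ((‖x - u‖ ^ 2 / 2 : ℝ) : EReal)) Set.univ p

/-- The proximal operator `prox_h(x) = argmin_u (h(u) + ‖x - u‖² / 2)`; for a proper closed convex
`h` on a finite-dimensional space the minimiser exists and is unique. -/
def prox {E : Type*} [NormedAddCommGroup E] [InnerProductSpace ℝ E]
    (h : E → EReal) (x : E) : E :=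
  Classical.epsilon (IsProxPoint h x)

/-- The data of a composite problem `min_x f(x) + h(A x - b)`. -/
structure CompositeProblem (m n : Type*) [Fintype m] [Fintype n] where
  f : EuclideanSpace ℝ n → ℝ
  h : EuclideanSpace ℝ m → EReal
  A : Matrix m n ℝ
  b : EuclideanSpace ℝ m

/-- The minimal singular value of a matrix (singular values are listed in decreasing order, starting
at index `0`; an `m × n` matrix has `min(m, n)` of them). -/
def minSingularValue {m n : Type*} [Fintype m] [Fintype n] [DecidableEq n]
    (A : Matrix m n ℝ) : ℝ :=
  (Matrix.toEuclideanLin A).singularValues (min (Fintype.card m) (Fintype.card n) - 1)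

/-- The condition number `‖A‖ / σ_min(A)`, with the spectral norm. -/
def condNumber {m n : Type*} [Fintype m] [Fintype n] [DecidableEq n]
    (A : Matrix m n ℝ) : ℝ :=
  ‖(Matrix.toEuclideanLin A).toContinuousLinearMap‖ / minSingularValue A

namespace CompositeProblem

/-- The affine map `x ↦ A x - b`. -/
def residual {m n : Type*} [Fintype m] [Fintype n] [DecidableEq n]
    (P : CompositeProblem m n) (x : EuclideanSpace ℝ n) : EuclideanSpace ℝ m :=
  Matrix.toEuclideanLin P.A x - P.b

/-- The objective `F(x) = f(x) + h(A x - b)`. -/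
def objective {m n : Type*} [Fintype m] [Fintype n] [DecidableEq n]
    (P : CompositeProblem m n) (x : EuclideanSpace ℝ n) : EReal :=
  (P.f x : EReal) + P.h (P.residual x)

/-- Membership in the nonconvex problem class with parameters `L`, `Δ`, `κ` and initial point `x₀`. -/
structure InClassNC {m n : Type*} [Fintype m] [Fintype n] [DecidableEq n]
    (P : CompositeProblem m n) (L Δ κ : ℝ) (x₀ : EuclideanSpace ℝ n) : Prop where
  smooth : IsSmoothWith L P.f
  proper_closed_convex : IsProperClosedConvex P.h
  full_row_rank : P.A.rank = Fintype.card m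
  cond_le : condNumber P.A ≤ κ
  mem_dom : P.objective x₀ ≠ ⊤
  gap_le : P.objective x₀ - ⨅ x, P.objective x ≤ (Δ : EReal)

/-- `L ‖x - prox_{h(A · - b) / L} (x - ∇f(x) / (2 L))‖`. -/
def subOptNC {m n : Type*} [Fintype m] [Fintype n] [DecidableEq n]
    (P : CompositeProblem m n) (L : ℝ) (x : EuclideanSpace ℝ n) : ℝ :=
  L * ‖x - prox (fun u => ((1 / L : ℝ) : EReal) * P.h (P.residual u))
    (x - (1 / (2 * L)) • ∇ P.f x)‖

/-- The sequences `(x_k, lam_k)` are generated inside the primal and dual search spaces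
`(Sx k, Sl k)`. A dual update may use the primal search spaces built so far, including the one of
the current step (as primal-dual methods that use `x_{k+1}` in the update of `lam_{k+1}` do). -/
structure IsLinearSpanRun {m n : Type*} [Fintype m] [Fintype n] [DecidableEq m] [DecidableEq n]
    (P : CompositeProblem m n)
    (x : ℕ → EuclideanSpace ℝ n) (lam : ℕ → EuclideanSpace ℝ m)
    (Sx : ℕ → Submodule ℝ (EuclideanSpace ℝ n)) (Sl : ℕ → Submodule ℝ (EuclideanSpace ℝ m)) :
    Prop where
  primal_zero : Sx 0 = Submodule.span ℝ {x 0}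
  dual_zero : Sl 0 = Submodule.span ℝ {lam 0}
  primal_succ : ∀ k, Sx (k + 1) = Submodule.span ℝ
    {v | ∃ i ≤ k, v = x i ∨ (∃ y ∈ Sx i, v = ∇ P.f y) ∨
      ∃ z ∈ Sl i, v = Matrix.toEuclideanLin P.A.transpose z}
  dual_succ : ∀ k, Sl (k + 1) = Submodule.span ℝ
    {w | ∃ i ≤ k, w = lam i ∨ ∃ z ∈ Sl i, ∃ j ≤ k + 1, ∃ y ∈ Sx j, ∃ η : ℝ, 0 < η ∧
      w = prox (fun u => (η : EReal) * conjugate P.h u) (z + η • P.residual y)}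
  primal_mem : ∀ k, x k ∈ Sx k
  dual_mem : ∀ k, lam k ∈ Sl k

/-- The iterates `(x_k, lam_k)` are generated by some first-order linear-span algorithm. -/
def IsFirstOrderLinearSpan {m n : Type*} [Fintype m] [Fintype n] [DecidableEq m] [DecidableEq n]
    (P : CompositeProblem m n)
    (x : ℕ → EuclideanSpace ℝ n) (lam : ℕ → EuclideanSpace ℝ m) : Prop :=
  ∃ (Sx : ℕ → Submodule ℝ (EuclideanSpace ℝ n)) (Sl : ℕ → Submodule ℝ (EuclideanSpace ℝ m)),
    P.IsLinearSpanRun x lam Sx Sl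

end CompositeProblem

/-- `Ψ(x) = 0` for `x ≤ 1/2` and `exp(1 - 1 / (2x - 1)²)` for `x > 1/2`. -/
def chainPsi (x : ℝ) : ℝ :=
  if x ≤ 1 / 2 then 0 else Real.exp (1 - 1 / (2 * x - 1) ^ 2)

/-- `Φ(x) = √e ∫_{-∞}^x exp(-t²/2) dt`. -/
def chainPhi (x : ℝ) : ℝ :=
  Real.sqrt (Real.exp 1) * ∫ t in Set.Iic x, Real.exp (-(1 / 2) * t ^ 2)

/-- `G₀(u, v) = -Ψ(1)Φ(u₁) + ∑_{i=2}^d [Ψ(-v_{i-1})Φ(-u_i) - Ψ(v_{i-1})Φ(u_i)]`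
(the coordinates are numbered from `0` in the code). -/
def chainG₀ (d : ℕ) (u v : EuclideanSpace ℝ (Fin d)) : ℝ :=
  ∑ i : Fin d,
    if (i : ℕ) = 0 then -(chainPsi 1 * chainPhi (u i))
    else
      chainPsi (-(v ⟨i - 1, by omega⟩)) * chainPhi (-(u i))
        - chainPsi (v ⟨i - 1, by omega⟩) * chainPhi (u i)

/-- `G(u, v) = (L α² / l₀) G₀(u / α, v / α)`. -/
def chainG (l₀ L α : ℝ) (d : ℕ) (u v : EuclideanSpace ℝ (Fin d)) : ℝ :=
  L * α ^ 2 / l₀ * chainG₀ d (α⁻¹ • u) (α⁻¹ • v)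

/-- The `i`-th block `x[i] ∈ ℝ^d` of a stacked vector `x ∈ ℝ^{M d}`. -/
def block {M d : ℕ} (x : EuclideanSpace ℝ (Fin M × Fin d)) (i : Fin M) :
    EuclideanSpace ℝ (Fin d) :=
  WithLp.toLp 2 fun a => x (i, a)

/-- `f₀(x) = G(x[1], x[N+1]) + ⋯ + G(x[N], x[2N])`. -/
def hardF (l₀ L α : ℝ) (N d : ℕ) (x : EuclideanSpace ℝ (Fin (2 * N) × Fin d)) : ℝ :=
  ∑ i : Fin N, chainG l₀ L α d (block x ⟨i, by omega⟩) (block x ⟨N + i, by omega⟩)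

/-- The block bidiagonal matrix with blocks `I_d` on the diagonal and `-I_d` right above it, so that
the `i`-th block of `A x` is `x[i] - x[i+1]`. -/
def hardA (N d : ℕ) : Matrix (Fin (2 * N - 1) × Fin d) (Fin (2 * N) × Fin d) ℝ :=
  fun r c =>
    if r.2 = c.2 then
      if (c.1 : ℕ) = r.1 then 1 else if (c.1 : ℕ) = r.1 + 1 then -1 else 0
    else 0

/-- The problem `min f₀(x)` subject to `x[1] = ⋯ = x[2N]`, i.e. `A x = 0`. -/
def hardProblem (l₀ L α : ℝ) (N d : ℕ) :
    CompositeProblem (Fin (2 * N - 1) × Fin d) (Fin (2 * N) × Fin d) where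
  f := hardF l₀ L α N d
  h := setIndicator {0}
  A := hardA N d
  b := 0

/-- `N = ⌊(κ + 1) / 2⌋`. -/
def hardN (κ : ℝ) : ℕ := ⌊(κ + 1) / 2⌋₊

/-- `K = ⌊(k - 2) / (N + 1)⌋ + 1`. -/
def hardK (κ : ℝ) (k : ℕ) : ℤ := ⌊((k : ℝ) - 2) / ((hardN κ : ℝ) + 1)⌋ + 1

/-- `d = K + 2` (for `k ≥ 1` one has `K ≥ 0`). -/
def hardDim (κ : ℝ) (k : ℕ) : ℕ := (hardK κ k + 2).toNat

/-- `α = √(l₀ Δ / (12 N d L))`. -/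
def hardScale (l₀ L Δ κ : ℝ) (k : ℕ) : ℝ :=
  Real.sqrt (l₀ * Δ / (12 * hardN κ * hardDim κ k * L))

end

/-! The hard function is a zero-chain stretched over a path of `2N` blocks. A summand of `chainG₀`
with `c ≠ 0` couples `u_c` to `v_{c-1}` only, and because `Ψ` and `Ψ'` vanish at `0`, both its
partial derivatives vanish while `v_{c-1} = 0`. In `hardF` the roles of `u` and `v` are played by
`x[i]` and `x[N+i]`. A gradient can therefore wake coordinate `c` only by jumping back from `x[N+i]`
to `x[i]`, and only products with `A` and its transpose carry it forward again, one block per step.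
Each new coordinate costs `N + 1` steps, so for `d` of order `k / N` the last coordinate is still
zero in every block after `k` steps (`iterate_mem_primalReach`, `unreached_last`).

A coordinate that is zero in every block forces a large gradient. At a consensus point, take the
first coordinate of size at most `α`: moving it in all blocks at once decreases `f` at rate at least
`N L α / l₀` (`exists_hardFDeriv_columnVec_le`). `le_subOptNC_sq` transfers this to points off the
consensus space and gives `SubOpt² ≥ L² α² N / (18 l₀²)`.

The gap at `0` is at most `12 N d L α² / l₀`, which fixes `α`, and the lower bound becomes a
multiple of `L Δ / d`, with `d` at most `5 k / κ`. The condition number of the path difference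
matrix is at most `2N - 1`, by a discrete Poincaré inequality (`sum_sq_le_sum_sq_sub`), so `N` may
be about `κ / 2`. The bound holds for all iterates up to `k` on the same instance, which is what the
complexity statement in `ε` needs. -/

noncomputable section

/-! ### Calculus of `Ψ` and `Φ`: derivatives, bounds, Lipschitz constants. -/

/-- The function `s ↦ s⁻ⁿ exp(-1/s²)` on the positive half-line, extended by zero. -/
def flatBump (n : ℕ) (s : ℝ) : ℝ :=
  if s ≤ 0 then 0 else s⁻¹ ^ n * Real.exp (-(s⁻¹ ^ 2))

lemma flatBump_of_nonpos (n : ℕ) {s : ℝ} (hs : s ≤ 0) : flatBump n s = 0 := if_pos hs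

lemma flatBump_of_pos (n : ℕ) {s : ℝ} (hs : 0 < s) :
    flatBump n s = s⁻¹ ^ n * Real.exp (-(s⁻¹ ^ 2)) := if_neg hs.not_ge

lemma flatBump_nonneg (n : ℕ) (s : ℝ) : 0 ≤ flatBump n s := by
  unfold flatBump
  split_ifs with h
  · exact le_rfl
  · have : 0 < s := not_le.mp h
    positivity

/-- With `z = 1/s ≥ 1`, `zⁿ ≤ (z²)ⁿ ≤ n! exp(z²)`; for `z ≤ 1` both factors are at most one. -/
lemma flatBump_le (n : ℕ) (s : ℝ) : flatBump n s ≤ n.factorial := by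
  rcases le_or_gt s 0 with h | h
  · rw [flatBump_of_nonpos n h]
    positivity
  rw [flatBump_of_pos n h]
  have hz : 0 < s⁻¹ := inv_pos.mpr h
  generalize s⁻¹ = z at hz
  have hfac : (1 : ℝ) ≤ n.factorial := by exact_mod_cast Nat.one_le_iff_ne_zero.mpr n.factorial_ne_zero
  rcases le_total z 1 with h1 | h1
  · calc z ^ n * Real.exp (-(z ^ 2)) ≤ 1 * 1 := by
          gcongr
          · exact pow_le_one₀ hz.le h1
          · exact Real.exp_le_one_iff.mpr (by nlinarith)
      _ ≤ _ := by simpa using hfac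
  · have h2 : (z ^ 2) ^ n / n.factorial ≤ Real.exp (z ^ 2) :=
      Real.pow_div_factorial_le_exp _ (by positivity) n
    rw [div_le_iff₀ (by positivity)] at h2
    have h3 : z ^ n ≤ (z ^ 2) ^ n := by
      gcongr
      nlinarith
    rw [Real.exp_neg, ← div_eq_mul_inv, div_le_iff₀ (Real.exp_pos _)]
    linarith

lemma abs_flatBump_le (n : ℕ) (s : ℝ) : |flatBump n s| ≤ n.factorial := by
  rw [abs_of_nonneg (flatBump_nonneg n s)]
  exact flatBump_le n s

lemma flatBump_eq_sq_mul (n : ℕ) (s : ℝ) : flatBump n s = s ^ 2 * flatBump (n + 2) s := by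
  rcases le_or_gt s 0 with h | h
  · simp [flatBump_of_nonpos _ h]
  · rw [flatBump_of_pos n h, flatBump_of_pos (n + 2) h, pow_add]
    field_simp

/-- The family is closed under differentiation, so the bound by `n!` controls `Ψ` and its first two
derivatives at once. -/
lemma hasDerivAt_flatBump (n : ℕ) (s : ℝ) :
    HasDerivAt (flatBump n) (-n * flatBump (n + 1) s + 2 * flatBump (n + 3) s) s := by
  rcases lt_trichotomy s 0 with h | h | h
  · rw [flatBump_of_nonpos _ h.le, flatBump_of_nonpos _ h.le]
    have : HasDerivAt (fun _ : ℝ => (0 : ℝ)) 0 s := hasDerivAt_const _ _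
    refine (this.congr_of_eventuallyEq ?_).congr_deriv (by simp)
    filter_upwards [Iio_mem_nhds h] with t ht using flatBump_of_nonpos n (le_of_lt ht)
  · subst h
    rw [flatBump_of_nonpos _ le_rfl, flatBump_of_nonpos _ le_rfl, hasDerivAt_iff_isLittleO]
    -- Flatness at the origin: `flatBump n` is `t²` times a bounded function, hence `o(t)`.
    have hO : (fun t : ℝ => flatBump n t) =O[nhds 0] fun t : ℝ => t ^ 2 := by
      refine Asymptotics.IsBigO.of_bound ((n + 2).factorial : ℝ) (Filter.Eventually.of_forall ?_)
      intro t
      rw [flatBump_eq_sq_mul, norm_mul, mul_comm]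
      gcongr
      exact abs_flatBump_le (n + 2) t
    have ho : (fun t : ℝ => t ^ 2) =o[nhds 0] fun t : ℝ => t := by
      simpa using Asymptotics.isLittleO_pow_pow (𝕜 := ℝ) (m := 1) (n := 2) (by norm_num)
    simpa [flatBump_of_nonpos n le_rfl] using hO.trans_isLittleO ho
  · have hs : s ≠ 0 := h.ne'
    have h1 := hasDerivAt_inv hs
    rw [← inv_pow] at h1
    have h2 : HasDerivAt (fun t : ℝ => t⁻¹ ^ n * Real.exp (-(t⁻¹ ^ 2)))
        (n * s⁻¹ ^ (n - 1) * -(s⁻¹ ^ 2) * Real.exp (-(s⁻¹ ^ 2)) +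
          s⁻¹ ^ n * (Real.exp (-(s⁻¹ ^ 2)) * -((2 : ℕ) * s⁻¹ ^ (2 - 1) * -(s⁻¹ ^ 2)))) s :=
      (h1.pow n).mul (((h1.pow 2).neg).exp)
    refine (h2.congr_of_eventuallyEq (f₁ := flatBump n) ?_).congr_deriv ?_
    · filter_upwards [Ioi_mem_nhds h] with t ht using flatBump_of_pos n ht
    rw [flatBump_of_pos _ h, flatBump_of_pos _ h]
    rcases n with _ | n
    · simp
      ring
    · simp only [Nat.add_sub_cancel]
      push_cast
      ring

/-- A function bounded by `B` and Lipschitz with constant `B`. -/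
def IsBoundedLipschitz (B : ℝ) (g : ℝ → ℝ) : Prop :=
  (∀ t, |g t| ≤ B) ∧ ∀ s t, |g s - g t| ≤ B * |s - t|

lemma IsBoundedLipschitz.mono {B B' : ℝ} {g : ℝ → ℝ} (h : IsBoundedLipschitz B g) (hB : B ≤ B') :
    IsBoundedLipschitz B' g :=
  ⟨fun t => (h.1 t).trans hB, fun s t => (h.2 s t).trans (by gcongr)⟩

lemma isBoundedLipschitz_of_hasDerivAt {g g' : ℝ → ℝ} {B : ℝ} (h : ∀ t, HasDerivAt g (g' t) t)
    (hg : ∀ t, |g t| ≤ B) (hg' : ∀ t, |g' t| ≤ B) : IsBoundedLipschitz B g := by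
  refine ⟨hg, fun s t => ?_⟩
  have := Convex.norm_image_sub_le_of_norm_hasDerivWithin_le (s := Set.univ) (f := g) (f' := g')
    (C := B) (fun x _ => (h x).hasDerivWithinAt) (fun x _ => hg' x) convex_univ
    (Set.mem_univ t) (Set.mem_univ s)
  simpa using this

/-- The derivative of `chainPsi`. -/
def chainPsiDeriv (t : ℝ) : ℝ := 4 * Real.exp 1 * flatBump 3 (2 * t - 1)

/-- The derivative of `chainPhi`. -/
def chainPhiDeriv (t : ℝ) : ℝ := Real.sqrt (Real.exp 1) * Real.exp (-(1 / 2) * t ^ 2)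

lemma chainPsi_eq_flatBump (t : ℝ) : chainPsi t = Real.exp 1 * flatBump 0 (2 * t - 1) := by
  unfold chainPsi flatBump
  have : t ≤ 1 / 2 ↔ 2 * t - 1 ≤ 0 := by constructor <;> intro h <;> linarith
  simp only [this]
  split_ifs
  · simp
  · rw [pow_zero, one_mul, ← Real.exp_add]
    congr 1
    rw [inv_pow]
    ring

lemma chainPsi_nonneg (t : ℝ) : 0 ≤ chainPsi t := by
  rw [chainPsi_eq_flatBump]
  exact mul_nonneg (Real.exp_pos _).le (flatBump_nonneg _ _)

lemma chainPsi_le (t : ℝ) : chainPsi t ≤ Real.exp 1 := by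
  rw [chainPsi_eq_flatBump]
  have h := flatBump_le 0 (2 * t - 1)
  simp only [Nat.factorial_zero, Nat.cast_one] at h
  nlinarith [Real.exp_pos 1]

lemma chainPsi_zero : chainPsi 0 = 0 := by
  rw [chainPsi_eq_flatBump, flatBump_of_nonpos _ (by norm_num), mul_zero]

lemma chainPsi_one : chainPsi 1 = 1 := by
  unfold chainPsi
  norm_num

lemma one_le_chainPsi {t : ℝ} (ht : 1 ≤ t) : 1 ≤ chainPsi t := by
  unfold chainPsi
  rw [if_neg (by linarith), Real.one_le_exp_iff, sub_nonneg]
  exact (div_le_one (by nlinarith)).mpr (by nlinarith)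

lemma chainPsiDeriv_nonneg (t : ℝ) : 0 ≤ chainPsiDeriv t := by
  unfold chainPsiDeriv
  have := flatBump_nonneg 3 (2 * t - 1)
  positivity

lemma chainPsiDeriv_zero : chainPsiDeriv 0 = 0 := by
  unfold chainPsiDeriv
  rw [flatBump_of_nonpos _ (by norm_num), mul_zero]

lemma hasDerivAt_flatBump_comp (n : ℕ) (t : ℝ) :
    HasDerivAt (fun t => flatBump n (2 * t - 1))
      (2 * (-n * flatBump (n + 1) (2 * t - 1) + 2 * flatBump (n + 3) (2 * t - 1))) t := by
  have h1 : HasDerivAt (fun t : ℝ => 2 * t - 1) 2 t := by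
    simpa using ((hasDerivAt_id t).const_mul 2).sub_const 1
  have := (hasDerivAt_flatBump n (2 * t - 1)).comp t h1
  rw [mul_comm]
  exact this

lemma hasDerivAt_chainPsi (t : ℝ) : HasDerivAt chainPsi (chainPsiDeriv t) t := by
  have h := (hasDerivAt_flatBump_comp 0 t).const_mul (Real.exp 1)
  have h2 : chainPsi = fun t => Real.exp 1 * flatBump 0 (2 * t - 1) :=
    funext chainPsi_eq_flatBump
  rw [h2]
  refine h.congr_deriv ?_
  unfold chainPsiDeriv
  push_cast
  ring

lemma exists_isBoundedLipschitz_flatBump_comp (c : ℝ) (n : ℕ) :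
    ∃ B, IsBoundedLipschitz B fun t => c * flatBump n (2 * t - 1) := by
  let D : ℝ := 2 * (n * (n + 1).factorial + 2 * (n + 3).factorial)
  refine ⟨|c| * max (n.factorial : ℝ) D, isBoundedLipschitz_of_hasDerivAt
    (fun t => (hasDerivAt_flatBump_comp n t).const_mul c) (fun t => ?_) fun t => ?_⟩
  · rw [abs_mul]
    gcongr
    exact (abs_flatBump_le _ _).trans (le_max_left _ _)
  · rw [abs_mul]
    gcongr
    refine le_trans ?_ (le_max_right _ _)
    have h1 := flatBump_le (n + 1) (2 * t - 1)
    have h2 := flatBump_le (n + 3) (2 * t - 1)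
    have h3 := flatBump_nonneg (n + 1) (2 * t - 1)
    have h4 := flatBump_nonneg (n + 3) (2 * t - 1)
    have hn : (0 : ℝ) ≤ n := by positivity
    have h5 := mul_le_mul_of_nonneg_left h1 hn
    have h6 := mul_nonneg hn h3
    simp only [D]
    rw [abs_le]
    constructor <;> linarith

lemma integrable_gaussian_half : MeasureTheory.Integrable fun t : ℝ => Real.exp (-(1 / 2) * t ^ 2) :=
  integrable_exp_neg_mul_sq (by norm_num)

lemma hasDerivAt_chainPhi (t : ℝ) : HasDerivAt chainPhi (chainPhiDeriv t) t := by
  have hc : Continuous fun t : ℝ => Real.exp (-(1 / 2) * t ^ 2) := by fun_prop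
  have h1 : HasDerivAt (fun x : ℝ => ∫ t in (0 : ℝ)..x, Real.exp (-(1 / 2) * t ^ 2))
      (Real.exp (-(1 / 2) * t ^ 2)) t :=
    intervalIntegral.integral_hasDerivAt_right (hc.intervalIntegrable _ _)
      (hc.stronglyMeasurableAtFilter _ _) hc.continuousAt
  have h2 : chainPhi = fun x => Real.sqrt (Real.exp 1) *
      ((∫ t in Set.Iic 0, Real.exp (-(1 / 2) * t ^ 2)) +
        ∫ t in (0 : ℝ)..x, Real.exp (-(1 / 2) * t ^ 2)) := by
    funext x
    rw [← intervalIntegral.integral_Iic_sub_Iic integrable_gaussian_half.integrableOn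
      integrable_gaussian_half.integrableOn]
    unfold chainPhi
    ring
  rw [h2]
  exact (h1.const_add _).const_mul _

lemma chainPhi_nonneg (t : ℝ) : 0 ≤ chainPhi t :=
  mul_nonneg (Real.sqrt_nonneg _)
    (MeasureTheory.integral_nonneg fun _ => (Real.exp_pos _).le)

lemma chainPhi_le (t : ℝ) : chainPhi t ≤ Real.sqrt (Real.exp 1) * Real.sqrt (2 * Real.pi) := by
  unfold chainPhi
  gcongr
  have h := integral_gaussian (1 / 2)
  rw [show Real.pi / (1 / 2) = 2 * Real.pi by ring] at h
  rw [← h]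
  exact MeasureTheory.setIntegral_le_integral integrable_gaussian_half
    (Filter.Eventually.of_forall fun _ => (Real.exp_pos _).le)

/-- The supremum is at most `e √e √(2π) ≈ 11.3`; the `12` in the scale `α` comes from here. -/
lemma chainPsi_mul_chainPhi_le (s t : ℝ) : chainPsi s * chainPhi t ≤ 12 := by
  have h1 : chainPsi s * chainPhi t ≤
      Real.exp 1 * (Real.sqrt (Real.exp 1) * Real.sqrt (2 * Real.pi)) :=
    mul_le_mul (chainPsi_le s) (chainPhi_le t) (chainPhi_nonneg t) (Real.exp_pos 1).le
  refine h1.trans (abs_le_of_sq_le_sq' ?_ (by norm_num)).2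
  rw [mul_pow, mul_pow, Real.sq_sqrt (Real.exp_pos 1).le,
    Real.sq_sqrt (by positivity)]
  have he : Real.exp 1 < 2.72 := Real.exp_one_lt_d9.trans (by norm_num)
  have hp : Real.pi < 3.15 := Real.pi_lt_d2
  have he0 := Real.exp_pos 1
  calc Real.exp 1 ^ 2 * (Real.exp 1 * (2 * Real.pi))
      ≤ 2.72 ^ 2 * (2.72 * (2 * 3.15)) := by gcongr
    _ ≤ 12 ^ 2 := by norm_num

lemma chainPhiDeriv_nonneg (t : ℝ) : 0 ≤ chainPhiDeriv t := by
  unfold chainPhiDeriv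
  positivity

lemma chainPhiDeriv_neg (t : ℝ) : chainPhiDeriv (-t) = chainPhiDeriv t := by
  unfold chainPhiDeriv
  rw [neg_sq]

lemma one_le_chainPhiDeriv {t : ℝ} (ht : |t| ≤ 1) : 1 ≤ chainPhiDeriv t := by
  unfold chainPhiDeriv
  rw [← Real.exp_half, ← Real.exp_add, Real.one_le_exp_iff]
  have := (sq_le_one_iff_abs_le_one t).mpr ht
  linarith

lemma hasDerivAt_chainPhiDeriv (t : ℝ) :
    HasDerivAt chainPhiDeriv (-t * chainPhiDeriv t) t := by
  have h1 : HasDerivAt (fun t : ℝ => -(1 / 2) * t ^ 2) (-t) t := by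
    have := ((hasDerivAt_id t).pow 2).const_mul (-(1 / 2) : ℝ)
    refine this.congr_deriv ?_
    simp
  refine (h1.exp.const_mul (Real.sqrt (Real.exp 1))).congr_deriv ?_
  unfold chainPhiDeriv
  ring

lemma abs_chainPhiDeriv_le (t : ℝ) : |chainPhiDeriv t| ≤ Real.sqrt (Real.exp 1) := by
  rw [abs_of_nonneg (chainPhiDeriv_nonneg t)]
  unfold chainPhiDeriv
  exact mul_le_of_le_one_right (Real.sqrt_nonneg _)
    (Real.exp_le_one_iff.mpr (by nlinarith [sq_nonneg t]))

lemma abs_mul_chainPhiDeriv_le (t : ℝ) : |-t * chainPhiDeriv t| ≤ Real.sqrt (Real.exp 1) := by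
  unfold chainPhiDeriv
  rw [abs_mul, abs_neg, abs_mul, abs_of_nonneg (Real.sqrt_nonneg _), Real.abs_exp, mul_left_comm]
  refine mul_le_of_le_one_right (Real.sqrt_nonneg _) ?_
  -- `|t| ≤ 1 + t²/2 ≤ exp(t²/2)`.
  have h := Real.add_one_le_exp (1 / 2 * t ^ 2)
  rw [neg_mul, Real.exp_neg, ← div_eq_mul_inv, div_le_one (Real.exp_pos _)]
  nlinarith [sq_nonneg (|t| - 1), sq_abs t]

lemma exists_isBoundedLipschitz_chain : ∃ B, 0 < B ∧ IsBoundedLipschitz B chainPsi ∧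
    IsBoundedLipschitz B chainPsiDeriv ∧ IsBoundedLipschitz B chainPhi ∧
    IsBoundedLipschitz B chainPhiDeriv := by
  obtain ⟨B₁, h₁⟩ := exists_isBoundedLipschitz_flatBump_comp (Real.exp 1) 0
  obtain ⟨B₂, h₂⟩ := exists_isBoundedLipschitz_flatBump_comp (4 * Real.exp 1) 3
  rw [← funext chainPsi_eq_flatBump] at h₁
  have h₄ : IsBoundedLipschitz (Real.sqrt (Real.exp 1)) chainPhiDeriv :=
    isBoundedLipschitz_of_hasDerivAt hasDerivAt_chainPhiDeriv abs_chainPhiDeriv_le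
      abs_mul_chainPhiDeriv_le
  have h₃ : IsBoundedLipschitz (max (Real.sqrt (Real.exp 1) * Real.sqrt (2 * Real.pi))
      (Real.sqrt (Real.exp 1))) chainPhi :=
    isBoundedLipschitz_of_hasDerivAt hasDerivAt_chainPhi
      (fun t => by
        rw [abs_of_nonneg (chainPhi_nonneg t)]
        exact (chainPhi_le t).trans (le_max_left _ _))
      (fun t => (abs_chainPhiDeriv_le t).trans (le_max_right _ _))
  refine ⟨max (max B₁ B₂) (max (Real.sqrt (Real.exp 1) * Real.sqrt (2 * Real.pi))
      (Real.sqrt (Real.exp 1))), lt_max_of_lt_right (lt_max_of_lt_right (by positivity)),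
    h₁.mono ((le_max_left _ _).trans (le_max_left _ _)),
    h₂.mono ((le_max_right _ _).trans (le_max_left _ _)), h₃.mono (le_max_right _ _),
    h₄.mono ((le_max_right _ _).trans (le_max_right _ _))⟩

/-! ### Smoothness of sums of functions of two linear functionals. -/

lemma inner_gradient_eq {E : Type*} [NormedAddCommGroup E] [InnerProductSpace ℝ E]
    [CompleteSpace E] {f : E → ℝ} {f' : E →L[ℝ] ℝ} {x : E} (h : HasFDerivAt f f' x) (w : E) :
    inner ℝ (∇ f x) w = f' w := by
  rw [gradient, InnerProductSpace.toDual_symm_apply, h.fderiv]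

/-- `φ` has partial derivatives `φ₁` and `φ₂`, and is jointly differentiable. -/
def HasPartials (φ φ₁ φ₂ : ℝ → ℝ → ℝ) : Prop :=
  ∀ s t, HasFDerivAt (fun q : ℝ × ℝ => φ q.1 q.2)
    (φ₁ s t • ContinuousLinearMap.fst ℝ ℝ ℝ + φ₂ s t • ContinuousLinearMap.snd ℝ ℝ ℝ) (s, t)

/-- `g` is `C`-Lipschitz for the `ℓ¹` norm on the plane. -/
def IsPlaneLipschitz (C : ℝ) (g : ℝ → ℝ → ℝ) : Prop :=
  ∀ s t s' t', |g s t - g s' t'| ≤ C * (|s - s'| + |t - t'|)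

lemma HasPartials.const_mul {φ φ₁ φ₂ : ℝ → ℝ → ℝ} (h : HasPartials φ φ₁ φ₂) (a : ℝ) :
    HasPartials (fun s t => a * φ s t) (fun s t => a * φ₁ s t) (fun s t => a * φ₂ s t) := by
  intro s t
  refine ((h s t).const_mul a).congr_fderiv ?_
  simp [smul_add, smul_smul]

lemma IsPlaneLipschitz.const_mul {C a : ℝ} {g : ℝ → ℝ → ℝ} (h : IsPlaneLipschitz C g)
    (ha : 0 ≤ a) : IsPlaneLipschitz (a * C) fun s t => a * g s t := by
  intro s t s' t'
  rw [← mul_sub, abs_mul, abs_of_nonneg ha, mul_assoc]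
  exact mul_le_mul_of_nonneg_left (h s t s' t') ha

section SumOfPairs

variable {E : Type*} [NormedAddCommGroup E] [InnerProductSpace ℝ E]
  {ρ : Type*} [Fintype ρ] {φ φ₁ φ₂ : ρ → ℝ → ℝ → ℝ}

lemma hasFDerivAt_sum_pairs (hφ : ∀ r, HasPartials (φ r) (φ₁ r) (φ₂ r)) (ℓ m : ρ → E →L[ℝ] ℝ)
    (x : E) : HasFDerivAt (fun x => ∑ r, φ r (ℓ r x) (m r x))
      (∑ r, (φ₁ r (ℓ r x) (m r x) • ℓ r + φ₂ r (ℓ r x) (m r x) • m r)) x := by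
  refine HasFDerivAt.fun_sum fun r _ => ?_
  have h1 : HasFDerivAt (fun x => (ℓ r x, m r x)) ((ℓ r).prod (m r)) x :=
    (ℓ r).hasFDerivAt.prodMk (m r).hasFDerivAt
  refine (HasFDerivAt.comp x (hφ r (ℓ r x) (m r x)) h1).congr_fderiv ?_
  ext w
  simp

lemma sum_mul_le_of_sum_sq_le {a b : ρ → ℝ} {A B : ℝ} (hA : 0 ≤ A) (hB : 0 ≤ B)
    (ha : ∑ r, a r ^ 2 ≤ A ^ 2) (hb : ∑ r, b r ^ 2 ≤ B ^ 2) : ∑ r, a r * b r ≤ A * B := by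
  refine (abs_le_of_sq_le_sq' ?_ (mul_nonneg hA hB)).2
  rw [mul_pow]
  exact (Finset.sum_mul_sq_le_sq_mul_sq _ _ _).trans
    (mul_le_mul ha hb (Finset.sum_nonneg fun _ _ => sq_nonneg _) (sq_nonneg _))

/-- The change of each partial derivative is at most `C` times the `ℓ¹` size of the increment;
Cauchy–Schwarz over the summands, with `(a + b)² ≤ 2 (a² + b²)`, gives `2 C D`. No second
derivatives are needed. -/
lemma isSmoothWith_sum_pairs [CompleteSpace E] {C D : ℝ} (hC : 0 ≤ C) (hD : 0 ≤ D)
    (hφ : ∀ r, HasPartials (φ r) (φ₁ r) (φ₂ r)) (h₁ : ∀ r, IsPlaneLipschitz C (φ₁ r))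
    (h₂ : ∀ r, IsPlaneLipschitz C (φ₂ r)) (ℓ m : ρ → E →L[ℝ] ℝ)
    (hb : ∀ x, ∑ r, (ℓ r x ^ 2 + m r x ^ 2) ≤ D * ‖x‖ ^ 2) :
    IsSmoothWith (2 * C * D) fun x => ∑ r, φ r (ℓ r x) (m r x) := by
  have hderiv := hasFDerivAt_sum_pairs hφ ℓ m
  refine ⟨fun x => (hderiv x).differentiableAt, fun x y => ?_⟩
  simp only [gradient]
  rw [← map_sub, LinearIsometryEquiv.norm_map, (hderiv x).fderiv, (hderiv y).fderiv]
  refine ContinuousLinearMap.opNorm_le_bound _ (by positivity) fun w => ?_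
  have hbound : ∀ z : E, ∑ r, (|ℓ r z| + |m r z|) ^ 2 ≤ (Real.sqrt (2 * D) * ‖z‖) ^ 2 := by
    intro z
    rw [mul_pow, Real.sq_sqrt (by positivity), mul_assoc]
    refine le_trans ?_ (mul_le_mul_of_nonneg_left (hb z) zero_le_two)
    rw [Finset.mul_sum]
    refine Finset.sum_le_sum fun r _ => ?_
    nlinarith [sq_nonneg (|ℓ r z| - |m r z|), sq_abs (ℓ r z), sq_abs (m r z)]
  have hsum := sum_mul_le_of_sum_sq_le (by positivity) (by positivity) (hbound (x - y)) (hbound w)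
  have hterm : ∀ r, |(φ₁ r (ℓ r x) (m r x) - φ₁ r (ℓ r y) (m r y)) * ℓ r w +
      (φ₂ r (ℓ r x) (m r x) - φ₂ r (ℓ r y) (m r y)) * m r w| ≤
      C * ((|ℓ r (x - y)| + |m r (x - y)|) * (|ℓ r w| + |m r w|)) := by
    intro r
    have k₁ := h₁ r (ℓ r x) (m r x) (ℓ r y) (m r y)
    have k₂ := h₂ r (ℓ r x) (m r x) (ℓ r y) (m r y)
    rw [← map_sub, ← map_sub] at k₁ k₂
    refine (abs_add_le _ _).trans ?_
    rw [abs_mul, abs_mul]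
    have e₁ := mul_le_mul_of_nonneg_right k₁ (abs_nonneg (ℓ r w))
    have e₂ := mul_le_mul_of_nonneg_right k₂ (abs_nonneg (m r w))
    linarith
  calc ‖_‖ = |∑ r, ((φ₁ r (ℓ r x) (m r x) - φ₁ r (ℓ r y) (m r y)) * ℓ r w +
      (φ₂ r (ℓ r x) (m r x) - φ₂ r (ℓ r y) (m r y)) * m r w)| := by
        rw [Real.norm_eq_abs, ← Finset.sum_sub_distrib]
        congr 1
        simp only [sum_apply, sub_apply,
          add_apply, smul_apply, smul_eq_mul]
        refine Finset.sum_congr rfl fun r _ => ?_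
        ring
    _ ≤ ∑ r, C * ((|ℓ r (x - y)| + |m r (x - y)|) * (|ℓ r w| + |m r w|)) :=
        (Finset.abs_sum_le_sum_abs _ _).trans (Finset.sum_le_sum fun r _ => hterm r)
    _ ≤ C * (Real.sqrt (2 * D) * ‖x - y‖ * (Real.sqrt (2 * D) * ‖w‖)) := by
        rw [← Finset.mul_sum]
        exact mul_le_mul_of_nonneg_left hsum hC
    _ = 2 * C * D * ‖x - y‖ * ‖w‖ := by
        have : Real.sqrt (2 * D) * Real.sqrt (2 * D) = 2 * D := Real.mul_self_sqrt (by positivity)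
        linear_combination C * ‖x - y‖ * ‖w‖ * this

end SumOfPairs

/-! ### The summands of `chainG₀` and their partial derivatives. -/

/-- The `c`-th summand of `chainG₀`, as a function of `v_{c-1}` and `u_c`. -/
def chainTerm (c : ℕ) (v u : ℝ) : ℝ :=
  if c = 0 then -(chainPsi 1 * chainPhi u)
  else chainPsi (-v) * chainPhi (-u) - chainPsi v * chainPhi u

/-- The derivative of `chainTerm` in its first variable. -/
def chainTermFst (c : ℕ) (v u : ℝ) : ℝ :=
  if c = 0 then 0
  else -(chainPsiDeriv (-v) * chainPhi (-u)) - chainPsiDeriv v * chainPhi u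

/-- The derivative of `chainTerm` in its second variable. -/
def chainTermSnd (c : ℕ) (v u : ℝ) : ℝ :=
  if c = 0 then -chainPhiDeriv u
  else -(chainPsi (-v) * chainPhiDeriv u) - chainPsi v * chainPhiDeriv u

/-- Both partial derivatives have a constant sign, so summing along a coordinate direction produces
no cancellation. -/
lemma chainTermFst_nonpos (c : ℕ) (v u : ℝ) : chainTermFst c v u ≤ 0 := by
  unfold chainTermFst
  split_ifs
  · exact le_rfl
  · have h₁ := mul_nonneg (chainPsiDeriv_nonneg (-v)) (chainPhi_nonneg (-u))
    have h₂ := mul_nonneg (chainPsiDeriv_nonneg v) (chainPhi_nonneg u)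
    linarith

/-- This and `chainTermSnd_zero_left` are the zero-chain mechanism: a zero in `v_{c-1}` silences the
whole `c`-th link. -/
lemma chainTermFst_zero_left (c : ℕ) (u : ℝ) : chainTermFst c 0 u = 0 := by
  simp [chainTermFst, chainPsiDeriv_zero]

lemma chainTermSnd_zero_left {c : ℕ} (hc : c ≠ 0) (u : ℝ) : chainTermSnd c 0 u = 0 := by
  simp [chainTermSnd, hc, chainPsi_zero]

/-- The large-gradient mechanism: if the previous coordinate is large, one of `Ψ(v)`, `Ψ(-v)` is at
least `1`, and `Φ'(u) ≥ 1` because `u` is small. -/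
lemma chainTermSnd_le {c : ℕ} {v u : ℝ} (hu : |u| ≤ 1) (hv : c = 0 ∨ 1 ≤ |v|) :
    chainTermSnd c v u ≤ -1 := by
  have h := one_le_chainPhiDeriv hu
  unfold chainTermSnd
  split_ifs with hc
  · linarith
  · have hv := hv.resolve_left hc
    have h₁ := chainPsi_nonneg (-v)
    have h₂ := chainPsi_nonneg v
    rcases le_abs.mp hv with hv | hv
    · nlinarith [one_le_chainPsi hv]
    · nlinarith [one_le_chainPsi hv]

lemma neg_le_chainTerm (c : ℕ) (v u : ℝ) : -12 ≤ chainTerm c v u := by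
  unfold chainTerm
  split_ifs
  · linarith [chainPsi_mul_chainPhi_le 1 u]
  · linarith [chainPsi_mul_chainPhi_le v u,
      mul_nonneg (chainPsi_nonneg (-v)) (chainPhi_nonneg (-u))]

lemma chainTerm_zero_nonpos (c : ℕ) : chainTerm c 0 0 ≤ 0 := by
  unfold chainTerm
  split_ifs
  · linarith [mul_nonneg (chainPsi_nonneg 1) (chainPhi_nonneg 0)]
  · simp [chainPsi_zero]

lemma hasPartials_mul {p p' q q' : ℝ → ℝ} (hp : ∀ t, HasDerivAt p (p' t) t)
    (hq : ∀ t, HasDerivAt q (q' t) t) :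
    HasPartials (fun s t => p s * q t) (fun s t => p' s * q t) (fun s t => p s * q' t) := by
  intro s t
  have h₁ : HasFDerivAt (fun z : ℝ × ℝ => p z.1) (p' s • ContinuousLinearMap.fst ℝ ℝ ℝ) (s, t) :=
    (hp s).comp_hasFDerivAt (s, t) hasFDerivAt_fst
  have h₂ : HasFDerivAt (fun z : ℝ × ℝ => q z.2) (q' t • ContinuousLinearMap.snd ℝ ℝ ℝ) (s, t) :=
    (hq t).comp_hasFDerivAt (s, t) hasFDerivAt_snd
  refine (h₁.mul h₂).congr_fderiv ?_
  ext <;> simp [mul_comm]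

lemma HasPartials.sub {φ φ₁ φ₂ ψ ψ₁ ψ₂ : ℝ → ℝ → ℝ} (h : HasPartials φ φ₁ φ₂)
    (k : HasPartials ψ ψ₁ ψ₂) : HasPartials (fun s t => φ s t - ψ s t)
      (fun s t => φ₁ s t - ψ₁ s t) (fun s t => φ₂ s t - ψ₂ s t) := by
  intro s t
  refine ((h s t).sub (k s t)).congr_fderiv ?_
  ext <;> simp

lemma hasDerivAt_comp_neg_apply {p p' : ℝ → ℝ} (hp : ∀ t, HasDerivAt p (p' t) t) (t : ℝ) :
    HasDerivAt (fun t => p (-t)) (-p' (-t)) t := by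
  exact ((hp (-t)).comp t (hasDerivAt_neg t)).congr_deriv (by simp)

lemma hasPartials_chainTerm (c : ℕ) :
    HasPartials (chainTerm c) (chainTermFst c) (chainTermSnd c) := by
  by_cases hc : c = 0
  · have h := hasPartials_mul (p := fun _ => -1) (p' := fun _ => 0)
      (fun t => hasDerivAt_const t (-1 : ℝ)) hasDerivAt_chainPhi
    have e₀ : chainTerm c = fun s t => -1 * chainPhi t := by
      funext s t
      simp [chainTerm, hc, chainPsi_one]
    have e₁ : chainTermFst c = fun s t => 0 * chainPhi t := by
      funext s t
      simp [chainTermFst, hc]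
    have e₂ : chainTermSnd c = fun s t => -1 * chainPhiDeriv t := by
      funext s t
      simp [chainTermSnd, hc]
    rw [e₀, e₁, e₂]
    exact h
  · have h := (hasPartials_mul (hasDerivAt_comp_neg_apply hasDerivAt_chainPsi)
      (hasDerivAt_comp_neg_apply hasDerivAt_chainPhi)).sub
      (hasPartials_mul hasDerivAt_chainPsi hasDerivAt_chainPhi)
    have e₀ : chainTerm c = fun s t =>
        chainPsi (-s) * chainPhi (-t) - chainPsi s * chainPhi t := by
      funext s t
      simp [chainTerm, hc]
    have e₁ : chainTermFst c = fun s t =>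
        -chainPsiDeriv (-s) * chainPhi (-t) - chainPsiDeriv s * chainPhi t := by
      funext s t
      simp [chainTermFst, hc]
    have e₂ : chainTermSnd c = fun s t =>
        chainPsi (-s) * -chainPhiDeriv (-t) - chainPsi s * chainPhiDeriv t := by
      funext s t
      simp [chainTermSnd, hc, chainPhiDeriv_neg]
    rw [e₀, e₁, e₂]
    exact h

lemma IsBoundedLipschitz.comp_neg {B : ℝ} {p : ℝ → ℝ} (hp : IsBoundedLipschitz B p) :
    IsBoundedLipschitz B fun t => p (-t) := by
  refine ⟨fun t => hp.1 _, fun s t => ?_⟩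
  have := hp.2 (-s) (-t)
  rwa [← neg_add', abs_neg, ← sub_eq_add_neg] at this

lemma isPlaneLipschitz_mul {B : ℝ} {p q : ℝ → ℝ} (hp : IsBoundedLipschitz B p)
    (hq : IsBoundedLipschitz B q) : IsPlaneLipschitz (B ^ 2) fun s t => p s * q t := by
  intro s t s' t'
  have hB : 0 ≤ B := (abs_nonneg _).trans (hp.1 0)
  calc |p s * q t - p s' * q t'| = |(p s - p s') * q t + p s' * (q t - q t')| := by ring_nf
    _ ≤ |p s - p s'| * |q t| + |p s'| * |q t - q t'| := by
        rw [← abs_mul, ← abs_mul]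
        exact abs_add_le _ _
    _ ≤ B * |s - s'| * B + B * (B * |t - t'|) := by
        gcongr
        exacts [hp.2 _ _, hq.1 _, hp.1 _, hq.2 _ _]
    _ = _ := by ring

lemma IsPlaneLipschitz.neg_sub {C : ℝ} {g k : ℝ → ℝ → ℝ} (hg : IsPlaneLipschitz C g)
    (hk : IsPlaneLipschitz C k) : IsPlaneLipschitz (2 * C) fun s t => -g s t - k s t := by
  intro s t s' t'
  have h₁ := abs_le.mp (hg s t s' t')
  have h₂ := abs_le.mp (hk s t s' t')
  rw [abs_le]
  constructor <;> linarith

lemma exists_isPlaneLipschitz_chainTerm : ∃ C, 0 < C ∧ ∀ c,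
    IsPlaneLipschitz C (chainTermFst c) ∧ IsPlaneLipschitz C (chainTermSnd c) := by
  obtain ⟨B, hB, hΨ, hΨ', hΦ, hΦ'⟩ := exists_isBoundedLipschitz_chain
  refine ⟨2 * B ^ 2 + B, by positivity, fun c => ?_⟩
  have hmono : ∀ {C₁ C₂ : ℝ} {g : ℝ → ℝ → ℝ}, C₁ ≤ C₂ → IsPlaneLipschitz C₁ g →
      IsPlaneLipschitz C₂ g := fun h hg s t s' t' => (hg s t s' t').trans (by gcongr)
  by_cases hc : c = 0
  · constructor
    · intro s t s' t'
      simp only [chainTermFst, hc, if_true, sub_self, abs_zero]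
      positivity
    · refine hmono (C₁ := B) (by nlinarith) fun s t s' t' => ?_
      simp only [chainTermSnd, hc, if_true]
      rw [← neg_sub', abs_neg]
      refine (hΦ'.2 t t').trans ?_
      gcongr
      linarith [abs_nonneg (s - s')]
  · constructor
    · refine hmono (C₁ := 2 * B ^ 2) (by linarith) ?_
      have := (isPlaneLipschitz_mul hΨ'.comp_neg hΦ.comp_neg).neg_sub (isPlaneLipschitz_mul hΨ' hΦ)
      intro s t s' t'
      simpa only [chainTermFst, hc, if_false] using this s t s' t'
    · refine hmono (C₁ := 2 * B ^ 2) (by linarith) ?_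
      have := (isPlaneLipschitz_mul hΨ.comp_neg hΦ').neg_sub (isPlaneLipschitz_mul hΨ hΦ')
      intro s t s' t'
      simpa only [chainTermSnd, hc, if_false] using this s t s' t'

/-! ### Smoothness and lower bounds for `chainG₀` and `hardF`. -/

lemma sum_shift_le {d : ℕ} (g : Fin d → ℝ) (hg : ∀ c, 0 ≤ g c) :
    ∑ c : Fin d, (if (c : ℕ) = 0 then 0 else g ⟨c - 1, by omega⟩) ≤ ∑ c, g c := by
  rcases d with _ | d
  · simp
  · rw [Fin.sum_univ_succ, Fin.sum_univ_castSucc]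
    simp only [Fin.val_zero, if_true, Fin.val_succ, Nat.succ_ne_zero, if_false, zero_add,
      Nat.add_sub_cancel]
    exact le_add_of_nonneg_right (hg _)

/-- The functional reading the coordinate of `v` that precedes `c`, zero for the first `c`. -/
def prevCoord {d : ℕ} (c : Fin d) : EuclideanSpace ℝ (Fin d) →L[ℝ] ℝ :=
  if (c : ℕ) = 0 then 0 else EuclideanSpace.proj (𝕜 := ℝ) (⟨c - 1, by omega⟩ : Fin d)

lemma sum_prevCoord_sq_le {d : ℕ} (v : EuclideanSpace ℝ (Fin d)) :
    ∑ c, prevCoord c v ^ 2 ≤ ‖v‖ ^ 2 := by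
  rw [EuclideanSpace.norm_sq_eq]
  refine le_trans (le_of_eq ?_) (sum_shift_le (fun c => ‖v c‖ ^ 2) fun c => sq_nonneg _)
  refine Finset.sum_congr rfl fun c _ => ?_
  unfold prevCoord
  split_ifs <;> simp

lemma chainG₀_eq_sum (d : ℕ) (u v : EuclideanSpace ℝ (Fin d)) :
    chainG₀ d u v = ∑ c : Fin d, chainTerm c (prevCoord c v) (u c) := by
  unfold chainG₀
  refine Finset.sum_congr rfl fun c _ => ?_
  unfold chainTerm prevCoord
  split_ifs <;> simp

lemma isSmoothWith_chainG₀ {C : ℝ} (hC : 0 < C) (h : ∀ c, IsPlaneLipschitz C (chainTermFst c) ∧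
    IsPlaneLipschitz C (chainTermSnd c)) (d : ℕ) : IsSmoothWith (2 * C)
      (fun p : WithLp 2 (EuclideanSpace ℝ (Fin d) × EuclideanSpace ℝ (Fin d)) =>
        chainG₀ d p.fst p.snd) := by
  have key := isSmoothWith_sum_pairs (ρ := Fin d)
    (E := WithLp 2 (EuclideanSpace ℝ (Fin d) × EuclideanSpace ℝ (Fin d))) hC.le zero_le_one
    (fun c => hasPartials_chainTerm c) (fun c => (h c).1) (fun c => (h c).2)
    (fun c => (prevCoord c).comp (WithLp.sndL 2 ℝ _ _))
    (fun c => (EuclideanSpace.proj (𝕜 := ℝ) c).comp (WithLp.fstL 2 ℝ _ _)) (fun p => by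
      rw [one_mul, WithLp.prod_norm_sq_eq_of_L2, Finset.sum_add_distrib, add_comm]
      refine add_le_add (le_of_eq ?_) (sum_prevCoord_sq_le p.snd)
      rw [EuclideanSpace.norm_sq_eq]
      simp)
  rw [mul_one] at key
  have e : (fun p : WithLp 2 (EuclideanSpace ℝ (Fin d) × EuclideanSpace ℝ (Fin d)) =>
      chainG₀ d p.fst p.snd) = fun p => ∑ c : Fin d, chainTerm c
        ((prevCoord c).comp (WithLp.sndL 2 ℝ _ _) p)
        ((EuclideanSpace.proj (𝕜 := ℝ) c).comp (WithLp.fstL 2 ℝ _ _) p) := by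
    funext p
    rw [chainG₀_eq_sum]
    rfl
  rw [e]
  exact key

section HardF

variable {N d : ℕ}

/-- The position of the `c`-th coordinate of `x[i]`, `i < N`. -/
def posFst (r : Fin N × Fin d) : Fin (2 * N) × Fin d := (⟨r.1, by omega⟩, r.2)

/-- The position of the coordinate before the `c`-th one of `x[N + i]`. -/
def posSnd (r : Fin N × Fin d) : Fin (2 * N) × Fin d :=
  (⟨N + r.1, by omega⟩, ⟨r.2 - 1, by omega⟩)

/-- The functional `x ↦ x[N + i]_{c-1}`, zero for the first `c`. -/
def readSnd (r : Fin N × Fin d) : EuclideanSpace ℝ (Fin (2 * N) × Fin d) →L[ℝ] ℝ :=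
  if (r.2 : ℕ) = 0 then 0 else EuclideanSpace.proj (𝕜 := ℝ) (posSnd r)

/-- The functional `x ↦ x[i]_c`. -/
def readFst (r : Fin N × Fin d) : EuclideanSpace ℝ (Fin (2 * N) × Fin d) →L[ℝ] ℝ :=
  EuclideanSpace.proj (𝕜 := ℝ) (posFst r)

lemma readFst_apply (r : Fin N × Fin d) (x : EuclideanSpace ℝ (Fin (2 * N) × Fin d)) :
    readFst r x = x (posFst r) := rfl

lemma readSnd_apply (r : Fin N × Fin d) (x : EuclideanSpace ℝ (Fin (2 * N) × Fin d)) :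
    readSnd r x = if (r.2 : ℕ) = 0 then 0 else x (posSnd r) := by
  unfold readSnd
  split_ifs <;> rfl

lemma sum_fin_two_mul (g : Fin (2 * N) → ℝ) :
    ∑ j, g j = ∑ i : Fin N, (g ⟨i, by omega⟩ + g ⟨N + i, by omega⟩) := by
  have h : 2 * N = N + N := two_mul N
  rw [← (finCongr h.symm).sum_comp, Fin.sum_univ_add, Finset.sum_add_distrib]
  rfl

lemma sum_read_sq_le (x : EuclideanSpace ℝ (Fin (2 * N) × Fin d)) :
    ∑ r, (readSnd r x ^ 2 + readFst r x ^ 2) ≤ ‖x‖ ^ 2 := by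
  rw [EuclideanSpace.norm_sq_eq, Fintype.sum_prod_type, Fintype.sum_prod_type, sum_fin_two_mul]
  refine Finset.sum_le_sum fun i _ => ?_
  rw [Finset.sum_add_distrib, add_comm]
  refine add_le_add (le_of_eq ?_) ?_
  · refine Finset.sum_congr rfl fun c _ => ?_
    simp [readFst_apply, posFst]
  · refine le_trans (le_of_eq ?_)
      (sum_shift_le (fun c => ‖x (⟨N + i, by omega⟩, c)‖ ^ 2) fun c => sq_nonneg _)
    refine Finset.sum_congr rfl fun c _ => ?_
    rw [readSnd_apply]
    split_ifs <;> simp [posSnd]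

variable (l₀ L α : ℝ)

lemma hardF_eq_sum (x : EuclideanSpace ℝ (Fin (2 * N) × Fin d)) :
    hardF l₀ L α N d x = ∑ r : Fin N × Fin d, L * α ^ 2 / l₀ *
      chainTerm r.2 ((α⁻¹ • readSnd r) x) ((α⁻¹ • readFst r) x) := by
  unfold hardF chainG
  rw [Fintype.sum_prod_type]
  refine Finset.sum_congr rfl fun i _ => ?_
  rw [chainG₀_eq_sum, Finset.mul_sum]
  refine Finset.sum_congr rfl fun c _ => ?_
  congr 2
  simp only [smul_apply, map_smul, readSnd_apply, smul_eq_mul]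
  congr 1
  unfold prevCoord
  split_ifs <;> rfl

/-- The derivative of `hardF`. -/
def hardFDeriv (N d : ℕ) (x : EuclideanSpace ℝ (Fin (2 * N) × Fin d)) :
    EuclideanSpace ℝ (Fin (2 * N) × Fin d) →L[ℝ] ℝ :=
  ∑ r : Fin N × Fin d,
    ((L * α ^ 2 / l₀ * chainTermFst r.2 ((α⁻¹ • readSnd r) x) ((α⁻¹ • readFst r) x)) •
        (α⁻¹ • readSnd r) +
      (L * α ^ 2 / l₀ * chainTermSnd r.2 ((α⁻¹ • readSnd r) x) ((α⁻¹ • readFst r) x)) •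
        (α⁻¹ • readFst r))

lemma hasFDerivAt_hardF (x : EuclideanSpace ℝ (Fin (2 * N) × Fin d)) :
    HasFDerivAt (hardF l₀ L α N d) (hardFDeriv l₀ L α N d x) x := by
  have h := hasFDerivAt_sum_pairs
    (fun r : Fin N × Fin d => (hasPartials_chainTerm r.2).const_mul (L * α ^ 2 / l₀))
    (fun r => α⁻¹ • readSnd r) (fun r => α⁻¹ • readFst r) x
  rw [funext (hardF_eq_sum l₀ L α)]
  exact h

variable {l₀ L α}

lemma hardFDeriv_apply (hα : α ≠ 0) (x w : EuclideanSpace ℝ (Fin (2 * N) × Fin d)) :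
    hardFDeriv l₀ L α N d x w = L * α / l₀ * ∑ r : Fin N × Fin d,
      (chainTermFst r.2 (α⁻¹ * readSnd r x) (α⁻¹ * readFst r x) * readSnd r w +
        chainTermSnd r.2 (α⁻¹ * readSnd r x) (α⁻¹ * readFst r x) * readFst r w) := by
  unfold hardFDeriv
  rw [Finset.mul_sum, sum_apply]
  refine Finset.sum_congr rfl fun r _ => ?_
  simp only [add_apply, smul_apply, smul_eq_mul]
  field_simp

/-- No coordinate of `x` is read by more than one functional, so the constant does not grow with `N`
or `d`; the factor `α²` cancels the two inner factors `α⁻¹`, and `l₀ = 2C` normalises the constant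
to `L`. -/
lemma isSmoothWith_hardF {C : ℝ} (hC : 0 < C)
    (h : ∀ c, IsPlaneLipschitz C (chainTermFst c) ∧ IsPlaneLipschitz C (chainTermSnd c))
    (hL : 0 < L) (hα : 0 < α) : IsSmoothWith L (hardF (2 * C) L α N d) := by
  have ha : 0 ≤ L * α ^ 2 / (2 * C) := by positivity
  have key := isSmoothWith_sum_pairs (D := α⁻¹ ^ 2) (mul_nonneg ha hC.le) (by positivity)
    (fun r : Fin N × Fin d => (hasPartials_chainTerm r.2).const_mul (L * α ^ 2 / (2 * C)))
    (fun r => (h r.2).1.const_mul ha) (fun r => (h r.2).2.const_mul ha)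
    (fun r => α⁻¹ • readSnd r) (fun r => α⁻¹ • readFst r) (fun x => by
      refine le_trans (le_of_eq ?_)
        (mul_le_mul_of_nonneg_left (sum_read_sq_le x) (sq_nonneg α⁻¹))
      rw [Finset.mul_sum]
      refine Finset.sum_congr rfl fun r _ => ?_
      simp only [smul_apply, smul_eq_mul]
      ring)
  have e : 2 * (L * α ^ 2 / (2 * C) * C) * α⁻¹ ^ 2 = L := by
    field_simp
  rw [e] at key
  rw [funext (hardF_eq_sum (2 * C) L α)]
  exact key

lemma neg_le_hardF (hl : 0 < l₀) (hL : 0 < L) (x : EuclideanSpace ℝ (Fin (2 * N) × Fin d)) :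
    -(L * α ^ 2 / l₀ * (12 * (N * d))) ≤ hardF l₀ L α N d x := by
  rw [hardF_eq_sum, ← Finset.mul_sum, ← mul_neg]
  refine mul_le_mul_of_nonneg_left ?_ (by positivity)
  have := Finset.card_nsmul_le_sum (Finset.univ : Finset (Fin N × Fin d))
    (fun r => chainTerm r.2 ((α⁻¹ • readSnd r) x) ((α⁻¹ • readFst r) x)) (-12)
    fun r _ => neg_le_chainTerm _ _ _
  simp only [Finset.card_univ, Fintype.card_prod, Fintype.card_fin, nsmul_eq_mul, Nat.cast_mul] at this
  linarith

lemma hardF_zero_nonpos (hl : 0 < l₀) (hL : 0 < L) : hardF l₀ L α N d 0 ≤ 0 := by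
  rw [hardF_eq_sum, ← Finset.mul_sum]
  refine mul_nonpos_of_nonneg_of_nonpos (by positivity) (Finset.sum_nonpos fun r _ => ?_)
  simpa using chainTerm_zero_nonpos r.2

end HardF

/-! ### The singular values of the path difference matrix. -/

/-- Comparison with the positive sequence `w_j = j (M - j)`, whose negative second difference is
`2`; the ratio `2 / w_j` is at least `8 / M²` by AM–GM. -/
lemma sum_sq_le_sum_sq_sub {M : ℕ} (hM : 2 ≤ M) (z : ℕ → ℝ) (h0 : z 0 = 0) (hz : z M = 0) :
    8 / (M : ℝ) ^ 2 * ∑ j ∈ Finset.range M, z j ^ 2 ≤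
      ∑ j ∈ Finset.range M, (z (j + 1) - z j) ^ 2 := by
  have hM' : (2 : ℝ) ≤ M := by exact_mod_cast hM
  have hw : ∀ a : ℝ, 0 < a → a < M → 8 / (M : ℝ) ^ 2 ≤ 2 / (a * (M - a)) := by
    intro a ha haM
    rw [div_le_div_iff₀ (by positivity) (mul_pos ha (by linarith))]
    nlinarith [sq_nonneg (M - 2 * a)]
  -- The extra coefficient is `(w_{n+1} - w_n) / w_{n+1}`, the boundary term left by a truncated
  -- summation by parts against `w`.
  have main : ∀ n : ℕ, n + 2 ≤ M →
      8 / (M : ℝ) ^ 2 * ∑ j ∈ Finset.range (n + 1), z j ^ 2 +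
        (M - 2 * (n + 1) + 1) / ((n + 1) * (M - (n + 1))) * z (n + 1) ^ 2 ≤
      ∑ j ∈ Finset.range (n + 1), (z (j + 1) - z j) ^ 2 := by
    intro n
    induction n with
    | zero =>
      intro _
      have : (M : ℝ) - 1 ≠ 0 := by linarith
      simp [h0]
      rw [show (M : ℝ) - 2 + 1 = M - 1 by ring, div_self this, one_mul]
    | succ n ih =>
      intro hn
      have ih := ih (by omega)
      have hn' : (n : ℝ) + 3 ≤ M := by exact_mod_cast hn
      have hn0 : (0 : ℝ) ≤ n := Nat.cast_nonneg n
      rw [Finset.sum_range_succ _ (n + 1), Finset.sum_range_succ (fun j => (z (j + 1) - z j) ^ 2) (n + 1)]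
      have hc := mul_le_mul_of_nonneg_right (hw (n + 1) (by linarith) (by linarith))
        (sq_nonneg (z (n + 1)))
      push_cast
      generalize z (n + 1 + 1) = b at *
      generalize z (n + 1) = a at *
      have hp : (0 : ℝ) < n + 1 := by linarith
      have hp2 : (0 : ℝ) < n + 1 + 1 := by linarith
      have hq : (0 : ℝ) < M - (n + 1) := by linarith
      have hq2 : (0 : ℝ) < M - (n + 1 + 1) := by linarith
      -- Picone's identity: the defect is the square `(w_{n+2} a - w_{n+1} b)² / (w_{n+1} w_{n+2})`.
      have key : (b - a) ^ 2 + (M - 2 * (n + 1) + 1) / ((n + 1) * (M - (n + 1))) * a ^ 2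
          - 2 / ((n + 1) * (M - (n + 1))) * a ^ 2
          - (M - 2 * (n + 1 + 1) + 1) / ((n + 1 + 1) * (M - (n + 1 + 1))) * b ^ 2 =
          ((n + 1 + 1) * (M - (n + 1 + 1)) * a - (n + 1) * (M - (n + 1)) * b) ^ 2 /
            ((n + 1) * (M - (n + 1)) * ((n + 1 + 1) * (M - (n + 1 + 1)))) := by
        field_simp
        ring
      have : 0 ≤ ((n + 1 + 1) * (M - (n + 1 + 1)) * a - (n + 1) * (M - (n + 1)) * b) ^ 2 /
            ((n + 1) * (M - (n + 1)) * ((n + 1 + 1) * (M - (n + 1 + 1)))) := by positivity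
      linarith
  obtain ⟨n, rfl⟩ : ∃ n, M = n + 2 := ⟨M - 2, by omega⟩
  have h := main n le_rfl
  have hc := mul_le_mul_of_nonneg_right (hw (n + 1) (by positivity) (by push_cast; linarith))
    (sq_nonneg (z (n + 1)))
  rw [Finset.sum_range_succ _ (n + 1), Finset.sum_range_succ (fun j => (z (j + 1) - z j) ^ 2) (n + 1)]
  rw [show z (n + 1 + 1) = 0 from hz]
  push_cast at h hc ⊢
  have hn : (0 : ℝ) < n + 1 := by positivity
  have e1 : ((n : ℝ) + 2 - 2 * (n + 1) + 1) / ((n + 1) * (n + 2 - (n + 1))) = 2 / (n + 1) - 1 := by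
    field_simp
    ring
  have e2 : 2 / (((n : ℝ) + 1) * (n + 2 - (n + 1))) = 2 / (n + 1) := by
    congr 1
    ring
  rw [e1] at h
  rw [e2] at hc
  linarith

/-- The endpoints are counted in one difference only; keeping this gain makes the constant `2`
instead of `4` when there are just two blocks. -/
lemma sum_sq_sub_le (n : ℕ) (x : ℕ → ℝ) : ∑ j ∈ Finset.range (n + 1), (x j - x (j + 1)) ^ 2 ≤
    4 * ∑ j ∈ Finset.range (n + 2), x j ^ 2 - 2 * x 0 ^ 2 - 2 * x (n + 1) ^ 2 := by
  induction n with
  | zero =>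
    simp [Finset.sum_range_succ]
    nlinarith [sq_nonneg (x 0 + x 1)]
  | succ n ih =>
    rw [Finset.sum_range_succ, Finset.sum_range_succ _ (n + 2)]
    nlinarith [sq_nonneg (x (n + 1) + x (n + 1 + 1))]

section ConditionNumber

variable {m n : Type*} [Fintype m] [Fintype n] [DecidableEq m]

lemma rank_eq_card_of_le_norm_transpose (A : Matrix m n ℝ) {a : ℝ} (ha : 0 < a)
    (h : ∀ y, a * ‖y‖ ^ 2 ≤ ‖Matrix.toEuclideanLin A.transpose y‖ ^ 2) :
    A.rank = Fintype.card m := by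
  have hinj : Function.Injective (Matrix.toEuclideanLin A.transpose) := by
    rw [injective_iff_map_eq_zero]
    intro y hy
    have := h y
    rw [hy, norm_zero] at this
    have h2 : ‖y‖ ^ 2 ≤ 0 := by nlinarith [sq_nonneg ‖y‖]
    exact norm_eq_zero.mp (pow_eq_zero_iff two_ne_zero |>.mp (le_antisymm h2 (sq_nonneg _)))
  rw [← Matrix.rank_transpose, Matrix.rank_eq_finrank_range_toLin A.transpose
    (PiLp.basisFun 2 ℝ n) (PiLp.basisFun 2 ℝ m), ← Matrix.toLpLin_eq_toLin,
    LinearMap.finrank_range_of_inj hinj, finrank_euclideanSpace]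

variable [DecidableEq n]

/-- Apply the lower bound for the transpose to `A v`, where `AᵀA v = σ² v`: it reads `a σ² ‖v‖² ≤ σ⁴
‖v‖²`, and full row rank gives `σ > 0`. -/
lemma le_sq_minSingularValue (A : Matrix m n ℝ) {a : ℝ} (ha : 0 < a)
    (hm : 0 < Fintype.card m) (hmn : Fintype.card m ≤ Fintype.card n)
    (h : ∀ y, a * ‖y‖ ^ 2 ≤ ‖Matrix.toEuclideanLin A.transpose y‖ ^ 2) :
    0 < minSingularValue A ∧ a ≤ minSingularValue A ^ 2 := by
  set T := Matrix.toEuclideanLin A with hT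
  have hrank : Module.finrank ℝ T.range = Fintype.card m := by
    rw [← rank_eq_card_of_le_norm_transpose A ha h, Matrix.rank_eq_finrank_range_toLin A
      (PiLp.basisFun 2 ℝ m) (PiLp.basisFun 2 ℝ n), ← Matrix.toLpLin_eq_toLin]
  have hidx : min (Fintype.card m) (Fintype.card n) - 1 = Fintype.card m - 1 := by
    rw [min_eq_left hmn]
  have hpos : 0 < minSingularValue A := by
    unfold minSingularValue
    rw [hidx, LinearMap.singularValues_pos_iff_lt_finrank_range, ← hT, hrank]
    omega
  refine ⟨hpos, ?_⟩
  have hadj : Matrix.toEuclideanLin A.transpose = LinearMap.adjoint T := by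
    rw [← Matrix.toEuclideanLin_conjTranspose_eq_adjoint, Matrix.conjTranspose_eq_transpose_of_trivial]
  have hlt : Fintype.card m - 1 < Module.finrank ℝ (EuclideanSpace ℝ n) := by
    rw [finrank_euclideanSpace]
    omega
  obtain ⟨v, hv⟩ := (T.hasEigenvalue_adjoint_comp_self_sq_singularValues hlt).exists_hasEigenvector
  have hs : minSingularValue A = T.singularValues (Fintype.card m - 1) := by
    unfold minSingularValue
    rw [hidx]
  rw [← hs] at hv
  have hv1 : LinearMap.adjoint T (T v) = minSingularValue A ^ 2 • v := hv.apply_eq_smul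
  have hvpos : 0 < ‖v‖ ^ 2 := by
    have := norm_pos_iff.mpr hv.2
    positivity
  have hTv : ‖T v‖ ^ 2 = minSingularValue A ^ 2 * ‖v‖ ^ 2 := by
    rw [← real_inner_self_eq_norm_sq, ← LinearMap.adjoint_inner_left, hv1, real_inner_smul_left,
      real_inner_self_eq_norm_sq]
  have h1 := h (T v)
  rw [hadj, hv1, norm_smul, mul_pow, hTv, Real.norm_eq_abs, sq_abs] at h1
  have hs2 : 0 < minSingularValue A ^ 2 * ‖v‖ ^ 2 := by positivity
  nlinarith

lemma condNumber_le (A : Matrix m n ℝ) {a b κ : ℝ} (ha : 0 < a) (hκ : 0 ≤ κ)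
    (hm : 0 < Fintype.card m) (hmn : Fintype.card m ≤ Fintype.card n) (hab : b ≤ κ ^ 2 * a)
    (h : ∀ y, a * ‖y‖ ^ 2 ≤ ‖Matrix.toEuclideanLin A.transpose y‖ ^ 2)
    (h' : ∀ x, ‖Matrix.toEuclideanLin A x‖ ^ 2 ≤ b * ‖x‖ ^ 2) : condNumber A ≤ κ := by
  obtain ⟨hpos, hle⟩ := le_sq_minSingularValue A ha hm hmn h
  unfold condNumber
  rw [div_le_iff₀ hpos]
  refine ContinuousLinearMap.opNorm_le_bound _ (by positivity) fun x => ?_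
  refine (abs_le_of_sq_le_sq' ?_ (by positivity)).2
  rw [LinearMap.coe_toContinuousLinearMap']
  refine (h' x).trans ?_
  rw [mul_pow, mul_pow]
  gcongr
  exact hab.trans (by gcongr)

end ConditionNumber

section HardA

variable {N d : ℕ}

lemma hardA_apply (x : EuclideanSpace ℝ (Fin (2 * N) × Fin d)) (r : Fin (2 * N - 1) × Fin d) :
    Matrix.toEuclideanLin (hardA N d) x r =
      x (⟨r.1, by omega⟩, r.2) - x (⟨r.1 + 1, by omega⟩, r.2) := by
  have e : ∀ c, hardA N d r c = (if c = (⟨r.1, by omega⟩, r.2) then 1 else 0) -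
      (if c = (⟨r.1 + 1, by omega⟩, r.2) then 1 else 0) := by
    rintro ⟨j, c⟩
    simp only [hardA, Prod.mk.injEq, Fin.ext_iff]
    split_ifs <;> first | (exfalso; omega) | norm_num
  simp [Matrix.toLpLin_apply, Matrix.mulVec, dotProduct, e, sub_mul,
    Finset.sum_sub_distrib]

/-- The blocks of `y`, numbered from `1` and extended by zero. -/
def dualExtend (y : EuclideanSpace ℝ (Fin (2 * N - 1) × Fin d)) (c : Fin d) (j : ℕ) : ℝ :=
  if h : 0 < j ∧ j < 2 * N then y (⟨j - 1, by omega⟩, c) else 0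

lemma hardA_transpose_apply (y : EuclideanSpace ℝ (Fin (2 * N - 1) × Fin d))
    (j : Fin (2 * N)) (c : Fin d) : Matrix.toEuclideanLin (hardA N d).transpose y (j, c) =
      dualExtend y c (j + 1) - dualExtend y c j := by
  have e : ∀ r, hardA N d r (j, c) =
      (if h : 0 < (j : ℕ) + 1 ∧ (j : ℕ) + 1 < 2 * N then
        (if r = (⟨j + 1 - 1, by omega⟩, c) then 1 else 0) else 0) -
      (if h : 0 < (j : ℕ) ∧ (j : ℕ) < 2 * N then
        (if r = (⟨j - 1, by omega⟩, c) then 1 else 0) else 0) := by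
    rintro ⟨r, c'⟩
    have := r.2
    simp only [hardA, Prod.mk.injEq, Fin.ext_iff]
    split_ifs <;> first | (exfalso; omega) | norm_num
  simp only [Matrix.toLpLin_apply, Matrix.mulVec, dotProduct, Matrix.transpose_apply, e,
    sub_mul, Finset.sum_sub_distrib, dualExtend]
  congr 1 <;> split_ifs <;> simp

lemma sum_dualExtend_sq (hN : 0 < N) (y : EuclideanSpace ℝ (Fin (2 * N - 1) × Fin d))
    (c : Fin d) : ∑ j ∈ Finset.range (2 * N), dualExtend y c j ^ 2 = ∑ r, y (r, c) ^ 2 := by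
  rw [show Finset.range (2 * N) = Finset.range (2 * N - 1 + 1) by congr 1; omega,
    Finset.sum_range_succ', ← Fin.sum_univ_eq_sum_range (fun j => dualExtend y c (j + 1) ^ 2)]
  have h0 : dualExtend y c 0 = 0 := by simp [dualExtend]
  rw [h0]
  simp only [ne_eq, OfNat.ofNat_ne_zero, not_false_eq_true, zero_pow, add_zero]
  refine Finset.sum_congr rfl fun r _ => ?_
  have : (r : ℕ) + 1 < 2 * N := by omega
  simp [dualExtend, this]

/-- For each coordinate, `Aᵀ y` is the difference sequence of `y` padded by a zero at both ends, so
the Poincaré inequality applies with `M = 2N`. -/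
lemma le_norm_hardA_transpose (hN : 0 < N) (y : EuclideanSpace ℝ (Fin (2 * N - 1) × Fin d)) :
    2 / (N : ℝ) ^ 2 * ‖y‖ ^ 2 ≤ ‖Matrix.toEuclideanLin (hardA N d).transpose y‖ ^ 2 := by
  rw [EuclideanSpace.norm_sq_eq, EuclideanSpace.norm_sq_eq, Fintype.sum_prod_type_right,
    Fintype.sum_prod_type_right, Finset.mul_sum]
  refine Finset.sum_le_sum fun c _ => ?_
  have h := sum_sq_le_sum_sq_sub (M := 2 * N) (by omega) (dualExtend y c) (by simp [dualExtend])
    (by simp [dualExtend])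
  rw [sum_dualExtend_sq hN,
    ← Fin.sum_univ_eq_sum_range (fun j => (dualExtend y c (j + 1) - dualExtend y c j) ^ 2)] at h
  simp only [Real.norm_eq_abs, sq_abs, hardA_transpose_apply]
  have e : 2 / (N : ℝ) ^ 2 = 8 / ((2 * N : ℕ) : ℝ) ^ 2 := by
    push_cast
    rw [mul_pow, show (8 : ℝ) = 2 ^ 2 * 2 by norm_num, mul_div_mul_left _ _ (by norm_num)]
  rw [e]
  exact h

lemma norm_hardA_le (hN : 0 < N) (x : EuclideanSpace ℝ (Fin (2 * N) × Fin d)) :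
    ‖Matrix.toEuclideanLin (hardA N d) x‖ ^ 2 ≤ (if N = 1 then 2 else 4) * ‖x‖ ^ 2 := by
  rw [EuclideanSpace.norm_sq_eq, EuclideanSpace.norm_sq_eq, Fintype.sum_prod_type_right,
    Fintype.sum_prod_type_right, Finset.mul_sum]
  refine Finset.sum_le_sum fun c _ => ?_
  let z : ℕ → ℝ := fun j => if h : j < 2 * N then x (⟨j, h⟩, c) else 0
  have e1 : ∑ r, ‖Matrix.toEuclideanLin (hardA N d) x (r, c)‖ ^ 2 =
      ∑ j ∈ Finset.range (2 * N - 1), (z j - z (j + 1)) ^ 2 := by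
    rw [← Fin.sum_univ_eq_sum_range (fun j => (z j - z (j + 1)) ^ 2)]
    refine Finset.sum_congr rfl fun r _ => ?_
    have h1 : (r : ℕ) < 2 * N := by omega
    have h2 : (r : ℕ) + 1 < 2 * N := by omega
    simp [hardA_apply, z, h1, h2]
  have e2 : ∑ j, ‖x (j, c)‖ ^ 2 = ∑ j ∈ Finset.range (2 * N), z j ^ 2 := by
    rw [← Fin.sum_univ_eq_sum_range (fun j => z j ^ 2)]
    refine Finset.sum_congr rfl fun j _ => ?_
    simp [z]
  rw [e1, e2]
  have h := sum_sq_sub_le (2 * N - 2) z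
  rw [show 2 * N - 2 + 1 = 2 * N - 1 by omega, show 2 * N - 2 + 2 = 2 * N by omega] at h
  split_ifs with h1
  · subst h1
    simp [Finset.sum_range_succ] at h ⊢
    linarith
  · linarith [sq_nonneg (z 0), sq_nonneg (z (2 * N - 1))]

lemma hardA_rank (hN : 0 < N) :
    (hardA N d).rank = Fintype.card (Fin (2 * N - 1) × Fin d) :=
  rank_eq_card_of_le_norm_transpose _ (by positivity) (le_norm_hardA_transpose hN)

/-- For `N ≥ 2` the bounds give `κ(A)² ≤ 2 N² ≤ (2N - 1)²`. The last inequality fails at `N = 1`,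
where the sharper norm bound gives `κ(A) ≤ 1`. -/
lemma condNumber_hardA_le (hN : 0 < N) (hd : 0 < d) {κ : ℝ} (hκ : 2 * N - 1 ≤ κ) :
    condNumber (hardA N d) ≤ κ := by
  have hN' : (1 : ℝ) ≤ N := by exact_mod_cast hN
  refine condNumber_le _ (by positivity) (by linarith) ?_ ?_ ?_ (le_norm_hardA_transpose hN)
    (norm_hardA_le hN)
  · simp only [Fintype.card_prod, Fintype.card_fin]
    exact Nat.mul_pos (by omega) hd
  · simp only [Fintype.card_prod, Fintype.card_fin]
    exact Nat.mul_le_mul_right _ (by omega)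
  · have hsq : (2 * (N : ℝ) - 1) ^ 2 ≤ κ ^ 2 := by gcongr; linarith
    rw [mul_div_assoc', le_div_iff₀ (by positivity)]
    split_ifs with h1
    · subst h1
      norm_num at hsq ⊢
      exact hsq
    · have h2 : (2 : ℝ) ≤ N := by
        have : 2 ≤ N := by omega
        exact_mod_cast this
      nlinarith

end HardA

/-! ### Indicator functions, their conjugates and proximal points. -/

lemma setIndicator_of_mem {E : Type*} {S : Set E} {z : E} (h : z ∈ S) : setIndicator S z = 0 :=
  if_pos h

lemma setIndicator_of_notMem {E : Type*} {S : Set E} {z : E} (h : z ∉ S) :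
    setIndicator S z = ⊤ := if_neg h

lemma setIndicator_nonneg {E : Type*} (S : Set E) (z : E) : 0 ≤ setIndicator S z := by
  by_cases h : z ∈ S
  · rw [setIndicator_of_mem h]
  · rw [setIndicator_of_notMem h]
    exact le_top

lemma coe_mul_setIndicator {E : Type*} {a : ℝ} (ha : 0 < a) (S : Set E) (z : E) :
    (a : EReal) * setIndicator S z = setIndicator S z := by
  by_cases h : z ∈ S
  · rw [setIndicator_of_mem h, mul_zero]
  · rw [setIndicator_of_notMem h, EReal.coe_mul_top_of_pos ha]

lemma setIndicator_zero_zero {E : Type*} [Zero E] : setIndicator ({0} : Set E) 0 = 0 :=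
  setIndicator_of_mem (Set.mem_singleton 0)

lemma setIndicator_zero_of_ne {E : Type*} [Zero E] {z : E} (hz : z ≠ 0) :
    setIndicator ({0} : Set E) z = ⊤ := setIndicator_of_notMem hz

section Indicator

variable {E : Type*} [NormedAddCommGroup E] [InnerProductSpace ℝ E]

lemma isProperClosedConvex_setIndicator_zero :
    IsProperClosedConvex (setIndicator ({0} : Set E)) where
  ne_bot z := (lt_of_lt_of_le EReal.bot_lt_zero (setIndicator_nonneg _ z)).ne'
  exists_ne_top := ⟨0, by
    rw [setIndicator_zero_zero]
    exact EReal.zero_ne_top⟩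
  closed := by
    intro z y hy
    by_cases hz : z = 0
    · rw [hz, setIndicator_zero_zero] at hy
      exact Filter.Eventually.of_forall fun w => hy.trans_le (setIndicator_nonneg _ w)
    · rw [setIndicator_zero_of_ne hz] at hy
      filter_upwards [isOpen_compl_singleton.mem_nhds hz] with w hw
      rwa [setIndicator_zero_of_ne hw]
  convex := by
    have e : {p : E × ℝ | setIndicator ({0} : Set E) p.1 ≤ (p.2 : EReal)} =
        ({0} : Set E) ×ˢ Set.Ici (0 : ℝ) := by
      ext p
      by_cases hp : p.1 = 0
      · simp [hp, setIndicator_zero_zero]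
      · simp [setIndicator_zero_of_ne hp, hp]
    rw [e]
    exact (convex_singleton 0).prod (convex_Ici 0)

lemma conjugate_setIndicator_zero (y : E) : conjugate (setIndicator ({0} : Set E)) y = 0 := by
  refine le_antisymm (iSup_le fun z => ?_) ?_
  · by_cases hz : z = 0
    · rw [hz, setIndicator_zero_zero]
      simp
    · rw [setIndicator_zero_of_ne hz]
      simp
  · refine le_trans ?_ (le_iSup _ (0 : E))
    rw [setIndicator_zero_zero]
    simp

lemma prox_zero (x : E) : prox (fun _ : E => (0 : EReal)) x = x := by
  have hx : IsProxPoint (fun _ : E => (0 : EReal)) x x := by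
    intro u _
    simp only [Set.mem_ofPred_eq, zero_add, EReal.coe_le_coe_iff, sub_self, norm_zero]
    have := sq_nonneg ‖x - u‖
    linarith
  have h : IsProxPoint (fun _ : E => (0 : EReal)) x (prox (fun _ : E => (0 : EReal)) x) :=
    Classical.epsilon_spec (p := IsProxPoint (fun _ : E => (0 : EReal)) x) ⟨x, hx⟩
  have h2 := h (Set.mem_univ x)
  simp only [Set.mem_ofPred_eq, zero_add, EReal.coe_le_coe_iff, sub_self, norm_zero] at h2
  have h3 : ‖x - prox (fun _ : E => (0 : EReal)) x‖ ^ 2 = 0 :=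
    le_antisymm (by linarith) (sq_nonneg _)
  exact (sub_eq_zero.mp (norm_eq_zero.mp ((pow_eq_zero_iff two_ne_zero).mp h3))).symm

/-- A proximal point of the indicator of a subspace is the orthogonal projection onto it. -/
lemma IsProxPoint.mem_and_inner_eq_zero {K : Submodule ℝ E} {y p : E}
    (h : IsProxPoint (setIndicator (K : Set E)) y p) :
    p ∈ K ∧ ∀ w ∈ K, inner ℝ (y - p) w = 0 := by
  have hp : p ∈ K := by
    by_contra hp
    have h2 := h (Set.mem_univ 0)
    simp only [Set.mem_ofPred_eq] at h2
    rw [setIndicator_of_notMem hp, setIndicator_of_mem K.zero_mem, zero_add,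
      EReal.top_add_coe] at h2
    exact absurd h2 (not_le.mpr (EReal.coe_lt_top _))
  refine ⟨hp, (K.norm_eq_iInf_iff_real_inner_eq_zero hp).mp ?_⟩
  refine le_antisymm (le_ciInf fun w => ?_)
    (ciInf_le (f := fun w : (K : Set E) => ‖y - w‖)
      ⟨0, by rintro _ ⟨w, rfl⟩; exact norm_nonneg _⟩ ⟨p, hp⟩)
  have h2 := h (Set.mem_univ (w : E))
  simp only [Set.mem_ofPred_eq] at h2
  rw [setIndicator_of_mem (show p ∈ (K : Set E) from hp), setIndicator_of_mem w.2, zero_add,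
    zero_add, EReal.coe_le_coe_iff] at h2
  refine (abs_le_of_sq_le_sq' ?_ (norm_nonneg _)).2
  linarith

/-- `prox` is a choice, so it has its defining property only once some minimiser is exhibited; the
orthogonal projection is one. -/
lemma isProxPoint_setIndicator_prox [FiniteDimensional ℝ E] (K : Submodule ℝ E) (y : E) :
    IsProxPoint (setIndicator (K : Set E)) y (prox (setIndicator (K : Set E)) y) := by
  refine Classical.epsilon_spec (p := IsProxPoint (setIndicator (K : Set E)) y)
    ⟨K.starProjection y, fun u _ => ?_⟩
  have hp : K.starProjection y ∈ (K : Set E) := K.starProjection_apply_mem y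
  simp only [Set.mem_ofPred_eq]
  rw [setIndicator_of_mem hp, zero_add]
  by_cases hu : u ∈ (K : Set E)
  · rw [setIndicator_of_mem hu, zero_add, EReal.coe_le_coe_iff]
    have h : ‖y - K.starProjection y‖ ≤ ‖y - u‖ := by
      rw [K.starProjection_minimal]
      exact ciInf_le (f := fun w : K => ‖y - w‖)
        ⟨0, by rintro _ ⟨w, rfl⟩; exact norm_nonneg _⟩ ⟨u, hu⟩
    gcongr
  · rw [setIndicator_of_notMem hu, EReal.top_add_coe]
    exact le_top

end Indicator

/-! ### Propagation of the support of the iterates. -/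

section ZeroChain

variable {N d : ℕ}

/-- The `c`-th coordinate of the `j`-th block cannot have been reached after `k` steps. -/
def Unreached (N k j c : ℕ) : Prop := k = 0 ∨ k + N < c * (N + 1) + j + 2

/-- The threshold is a moving front: coordinate `c` of block `j` opens at step `c (N + 1) + j + 2 -
N`, or at step `1` if that is larger. It advances one block per step, and block `N + i` at
coordinate `c - 1` opens one step before block `i` at coordinate `c`. The case `k = 0` is separate
because the formula alone would already open early blocks at the start. -/
lemma Unreached.anti {k k' j c : ℕ} (h : Unreached N k j c) (hk : k' ≤ k) : Unreached N k' j c := by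
  unfold Unreached at *
  omega

/-- The vectors supported on the coordinates of `x` reached after `k` steps. -/
def primalReach (N d k : ℕ) : Submodule ℝ (EuclideanSpace ℝ (Fin (2 * N) × Fin d)) where
  carrier := {x | ∀ (j : Fin (2 * N)) (c : Fin d), Unreached N k j c → x (j, c) = 0}
  add_mem' hx hy j c h := by simp [hx j c h, hy j c h]
  zero_mem' j c _ := rfl
  smul_mem' a x hx j c h := by simp [hx j c h]

/-- The vectors supported on the coordinates of the multiplier reached after `k` steps. -/
def dualReach (N d k : ℕ) : Submodule ℝ (EuclideanSpace ℝ (Fin (2 * N - 1) × Fin d)) where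
  carrier := {x | ∀ (j : Fin (2 * N - 1)) (c : Fin d), Unreached N k j c → x (j, c) = 0}
  add_mem' hx hy j c h := by simp [hx j c h, hy j c h]
  zero_mem' j c _ := rfl
  smul_mem' a x hx j c h := by simp [hx j c h]

lemma primalReach_mono {k k' : ℕ} (h : k ≤ k') : primalReach N d k ≤ primalReach N d k' :=
  fun _ hx j c hu => hx j c (hu.anti h)

lemma dualReach_mono {k k' : ℕ} (h : k ≤ k') : dualReach N d k ≤ dualReach N d k' :=
  fun _ hx j c hu => hx j c (hu.anti h)

lemma hardA_mem_dualReach {k : ℕ} {x : EuclideanSpace ℝ (Fin (2 * N) × Fin d)}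
    (hx : x ∈ primalReach N d k) : Matrix.toEuclideanLin (hardA N d) x ∈ dualReach N d k := by
  intro j c h
  rw [hardA_apply, hx _ _ h, hx _ _ (show Unreached N k _ _ from ?_), sub_zero]
  unfold Unreached at *
  simp only
  omega

/-- Block `j` of `Aᵀ y` involves the multipliers `j - 1` and `j`, so the front moves forward by one
block. -/
lemma hardA_transpose_mem_primalReach {k : ℕ}
    {y : EuclideanSpace ℝ (Fin (2 * N - 1) × Fin d)} (hy : y ∈ dualReach N d k) :
    Matrix.toEuclideanLin (hardA N d).transpose y ∈ primalReach N d (k + 1) := by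
  intro j c h
  have hz : ∀ i, Unreached N k (i - 1) c → dualExtend y c i = 0 := by
    intro i hi
    unfold dualExtend
    split_ifs
    · exact hy _ _ hi
    · rfl
  unfold Unreached at *
  rw [hardA_transpose_apply, hz _ (by omega), hz _ (by omega), sub_zero]

lemma gradient_hardF_apply {l₀ L α : ℝ} (x : EuclideanSpace ℝ (Fin (2 * N) × Fin d))
    (q : Fin (2 * N) × Fin d) :
    ∇ (hardF l₀ L α N d) x q = hardFDeriv l₀ L α N d x (EuclideanSpace.single q 1) := by
  rw [← inner_gradient_eq (hasFDerivAt_hardF l₀ L α x), EuclideanSpace.inner_single_right]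
  simp

/-- Each link is silent unless its `x[N+i]_{c-1}` is already open; then the only new coordinate it
can open is `x[i]_c`, which is due one step later. -/
lemma gradient_hardF_mem_primalReach {l₀ L α : ℝ} (hα : α ≠ 0) {k : ℕ}
    {x : EuclideanSpace ℝ (Fin (2 * N) × Fin d)} (hx : x ∈ primalReach N d k) :
    ∇ (hardF l₀ L α N d) x ∈ primalReach N d (k + 1) := by
  intro j c h
  rw [gradient_hardF_apply, hardFDeriv_apply hα, Finset.sum_eq_zero, mul_zero]
  rintro ⟨i, e⟩ -
  have hread : (e : ℕ) ≠ 0 → Unreached N k (N + i) (e - 1) → readSnd (i, e) x = 0 := by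
    intro he hu
    rw [readSnd_apply, if_neg he]
    exact hx _ _ hu
  have h₁ : chainTermFst e (α⁻¹ * readSnd (i, e) x) (α⁻¹ * readFst (i, e) x) *
      readSnd (i, e) (EuclideanSpace.single (j, c) 1) = 0 := by
    by_cases he : (e : ℕ) = 0
    · simp [readSnd_apply, he]
    by_cases hjc : posSnd (i, e) = (j, c)
    · simp only [posSnd, Prod.mk.injEq, Fin.ext_iff] at hjc
      rw [hread he, mul_zero, chainTermFst_zero_left, zero_mul]
      rw [hjc.1, hjc.2]
      exact h.anti (Nat.le_succ k)
    · simp [readSnd_apply, he, hjc]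
  have h₂ : chainTermSnd e (α⁻¹ * readSnd (i, e) x) (α⁻¹ * readFst (i, e) x) *
      readFst (i, e) (EuclideanSpace.single (j, c) 1) = 0 := by
    by_cases hjc : posFst (i, e) = (j, c)
    · simp only [posFst, Prod.mk.injEq, Fin.ext_iff] at hjc
      have hi := i.2
      unfold Unreached at h hread
      rw [← hjc.1, ← hjc.2] at h
      -- The first coordinate of a block `i < N` is open from step one on, so it cannot be unreached
      -- at `k + 1`.
      have he : (e : ℕ) ≠ 0 := by
        intro he
        rw [he] at h
        omega
      rw [hread he, mul_zero, chainTermSnd_zero_left he, zero_mul]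
      -- Writing `e = e' + 1`, the thresholds agree exactly: `e (N + 1) + i = e' (N + 1) + (N + i) +
      -- 1`.
      obtain ⟨e', he'⟩ := Nat.exists_eq_succ_of_ne_zero he
      rw [he'] at h ⊢
      rw [Nat.succ_mul] at h
      simp only [Nat.succ_eq_add_one, Nat.add_sub_cancel]
      omega
    · simp [readFst_apply, hjc]
  simp only at h₁ h₂ ⊢
  rw [h₁, h₂, add_zero]

/-- The conjugate of the indicator of `{0}` is zero, so a dual update merely adds a multiple of `A
x`. -/
lemma prox_hardProblem_dual {l₀ L α η : ℝ}
    (z : EuclideanSpace ℝ (Fin (2 * N - 1) × Fin d)) :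
    prox (fun u => (η : EReal) * conjugate (hardProblem l₀ L α N d).h u) z = z := by
  have e : (fun u => (η : EReal) * conjugate (hardProblem l₀ L α N d).h u) = fun _ => 0 := by
    funext u
    rw [show (hardProblem l₀ L α N d).h = setIndicator {0} from rfl, conjugate_setIndicator_zero,
      mul_zero]
  rw [e, prox_zero]

lemma residual_hardProblem {l₀ L α : ℝ} (x : EuclideanSpace ℝ (Fin (2 * N) × Fin d)) :
    (hardProblem l₀ L α N d).residual x = Matrix.toEuclideanLin (hardA N d) x :=
  sub_zero _

lemma iterate_mem_primalReach {l₀ L α : ℝ} (hα : α ≠ 0)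
    {x : ℕ → EuclideanSpace ℝ (Fin (2 * N) × Fin d)}
    {lam : ℕ → EuclideanSpace ℝ (Fin (2 * N - 1) × Fin d)}
    (h : (hardProblem l₀ L α N d).IsFirstOrderLinearSpan x lam) (hx : x 0 = 0) (hl : lam 0 = 0)
    (k : ℕ) : x k ∈ primalReach N d k := by
  obtain ⟨Sx, Sl, hS⟩ := h
  have key : ∀ k, ∀ i ≤ k, Sx i ≤ primalReach N d i ∧ Sl i ≤ dualReach N d i := by
    intro k
    induction k with
    | zero =>
      intro i hi
      obtain rfl : i = 0 := Nat.le_zero.mp hi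
      rw [hS.primal_zero, hS.dual_zero, hx, hl]
      simp
    | succ k ih =>
      intro i hi
      rcases Nat.le_succ_iff.mp hi with hi | rfl
      · exact ih i hi
      -- The primal space comes first because the dual update of the same step may use it.
      have hp : Sx (k + 1) ≤ primalReach N d (k + 1) := by
        rw [hS.primal_succ, Submodule.span_le]
        rintro v ⟨i, hi, rfl | ⟨y, hy, rfl⟩ | ⟨z, hz, rfl⟩⟩
        · exact primalReach_mono (by omega) ((ih i hi).1 (hS.primal_mem i))
        · exact gradient_hardF_mem_primalReach hα (primalReach_mono hi ((ih i hi).1 hy))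
        · exact hardA_transpose_mem_primalReach (dualReach_mono hi ((ih i hi).2 hz))
      refine ⟨hp, ?_⟩
      rw [hS.dual_succ, Submodule.span_le]
      rintro w ⟨i, hi, rfl | ⟨z, hz, j, hj, y, hy, η, hη, rfl⟩⟩
      · exact dualReach_mono (by omega) ((ih i hi).2 (hS.dual_mem i))
      · rw [prox_hardProblem_dual, residual_hardProblem]
        refine Submodule.add_mem _ (dualReach_mono (by omega) ((ih i hi).2 hz))
          (Submodule.smul_mem _ _ (hardA_mem_dualReach ?_))
        rcases Nat.le_succ_iff.mp hj with hj | rfl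
        · exact primalReach_mono (by omega) ((ih j hj).1 hy)
        · exact hp hy
  exact (key k k le_rfl).1 (hS.primal_mem k)

end ZeroChain

/-! ### Class membership and the stationarity lower bound. -/

section Problem

variable {N d : ℕ} {l₀ L α : ℝ}

lemma objective_hardProblem_ge (hl : 0 < l₀) (hL : 0 < L)
    (x : EuclideanSpace ℝ (Fin (2 * N) × Fin d)) :
    ((-(L * α ^ 2 / l₀ * (12 * (N * d))) : ℝ) : EReal) ≤ (hardProblem l₀ L α N d).objective x := by
  refine (EReal.coe_le_coe_iff.mpr (neg_le_hardF hl hL x)).trans ?_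
  exact le_add_of_nonneg_right (setIndicator_nonneg _ _)

lemma objective_hardProblem_zero :
    (hardProblem l₀ L α N d).objective 0 = (hardF l₀ L α N d 0 : EReal) := by
  unfold CompositeProblem.objective
  rw [residual_hardProblem, map_zero]
  change _ + setIndicator {0} 0 = _
  rw [setIndicator_zero_zero, add_zero]
  rfl

lemma inClassNC_hardProblem {C Δ κ : ℝ} (hC : 0 < C)
    (h : ∀ c, IsPlaneLipschitz C (chainTermFst c) ∧ IsPlaneLipschitz C (chainTermSnd c))
    (hL : 0 < L) (hα : 0 < α) (hN : 0 < N) (hd : 0 < d) (hκ : 2 * N - 1 ≤ κ)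
    (hΔ : L * α ^ 2 / (2 * C) * (12 * (N * d)) ≤ Δ) :
    (hardProblem (2 * C) L α N d).InClassNC L Δ κ 0 where
  smooth := isSmoothWith_hardF hC h hL hα
  proper_closed_convex := isProperClosedConvex_setIndicator_zero
  full_row_rank := hardA_rank hN
  cond_le := condNumber_hardA_le hN hd hκ
  mem_dom := by
    rw [objective_hardProblem_zero]
    exact EReal.coe_ne_top _
  gap_le := by
    have h1 : (hardProblem (2 * C) L α N d).objective 0 ≤ 0 := by
      rw [objective_hardProblem_zero]
      exact_mod_cast hardF_zero_nonpos (by positivity) hL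
    have h2 : ((-Δ : ℝ) : EReal) ≤ ⨅ x, (hardProblem (2 * C) L α N d).objective x :=
      le_iInf fun x => (EReal.coe_le_coe_iff.mpr (neg_le_neg hΔ)).trans
        (objective_hardProblem_ge (by positivity) hL x)
    refine (EReal.sub_le_sub h1 h2).trans ?_
    rw [← EReal.coe_zero, ← EReal.coe_sub, EReal.coe_le_coe_iff]
    linarith

lemma subOptNC_hardProblem (hL : 0 < L) (x : EuclideanSpace ℝ (Fin (2 * N) × Fin d)) :
    (hardProblem l₀ L α N d).subOptNC L x =
      L * ‖x - prox (setIndicator ((Matrix.toEuclideanLin (hardA N d)).ker : Set _))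
        (x - (1 / (2 * L)) • ∇ (hardF l₀ L α N d) x)‖ := by
  unfold CompositeProblem.subOptNC
  congr 3
  refine congrArg (fun g => prox g _) (funext fun u => ?_)
  rw [residual_hardProblem]
  change _ * setIndicator {0} _ = _
  rw [coe_mul_setIndicator (by positivity)]
  by_cases hu : Matrix.toEuclideanLin (hardA N d) u = 0
  · rw [hu, setIndicator_zero_zero, setIndicator_of_mem]
    exact hu
  · rw [setIndicator_zero_of_ne hu, setIndicator_of_notMem]
    exact hu

lemma apply_eq_of_mem_ker {x : EuclideanSpace ℝ (Fin (2 * N) × Fin d)}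
    (hx : x ∈ (Matrix.toEuclideanLin (hardA N d)).ker) (hN : 0 < N) (j : Fin (2 * N)) (c : Fin d) :
    x (j, c) = x (⟨0, by omega⟩, c) := by
  obtain ⟨j, hj⟩ := j
  induction j with
  | zero => rfl
  | succ j ih =>
    rw [← ih (by omega)]
    have h := hardA_apply x (⟨j, by omega⟩, c)
    rw [LinearMap.mem_ker.mp hx] at h
    exact (sub_eq_zero.mp h.symm).symm

/-- The vector all of whose blocks are the `c`-th standard basis vector. -/
def columnVec (N : ℕ) {d : ℕ} (c : Fin d) : EuclideanSpace ℝ (Fin (2 * N) × Fin d) :=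
  WithLp.toLp 2 fun q => if q.2 = c then 1 else 0

lemma columnVec_apply (c : Fin d) (q : Fin (2 * N) × Fin d) :
    columnVec N c q = if q.2 = c then 1 else 0 := rfl

lemma columnVec_mem_ker (c : Fin d) :
    columnVec N c ∈ (Matrix.toEuclideanLin (hardA N d)).ker := by
  rw [LinearMap.mem_ker]
  ext r
  rw [hardA_apply, columnVec_apply, columnVec_apply, sub_self]
  rfl

lemma inner_columnVec (y : EuclideanSpace ℝ (Fin (2 * N) × Fin d)) (c : Fin d) :
    inner ℝ y (columnVec N c) = ∑ j, y (j, c) := by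
  simp [PiLp.inner_apply, columnVec_apply, Fintype.sum_prod_type]

lemma norm_columnVec_sq (c : Fin d) : ‖columnVec N c‖ ^ 2 = 2 * N := by
  rw [← real_inner_self_eq_norm_sq, inner_columnVec]
  simp [columnVec_apply]

/-- Each of the `N` links into coordinate `c` contributes at most `-1`; the links leaving `c` act
through `chainTermFst`, which is nonpositive. -/
lemma hardFDeriv_columnVec_le (hl : 0 < l₀) (hL : 0 < L) (hα : 0 < α)
    {x : EuclideanSpace ℝ (Fin (2 * N) × Fin d)} {c : Fin d} (hc : ∀ j, |x (j, c)| ≤ α)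
    (hp : (c : ℕ) = 0 ∨ ∀ j, α ≤ |x (j, ⟨c - 1, by omega⟩)|) :
    hardFDeriv l₀ L α N d x (columnVec N c) ≤ -(L * α / l₀ * N) := by
  rw [hardFDeriv_apply hα.ne', ← mul_neg]
  refine mul_le_mul_of_nonneg_left ?_ (by positivity)
  have hterm : ∀ r : Fin N × Fin d,
      chainTermFst r.2 (α⁻¹ * readSnd r x) (α⁻¹ * readFst r x) * readSnd r (columnVec N c) +
        chainTermSnd r.2 (α⁻¹ * readSnd r x) (α⁻¹ * readFst r x) * readFst r (columnVec N c) ≤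
      if r.2 = c then -1 else 0 := by
    rintro ⟨i, e⟩
    have h0 : 0 ≤ readSnd (i, e) (columnVec N c) := by
      rw [readSnd_apply, columnVec_apply]
      split_ifs <;> norm_num
    have h1 := mul_nonpos_of_nonpos_of_nonneg
      (chainTermFst_nonpos e (α⁻¹ * readSnd (i, e) x) (α⁻¹ * readFst (i, e) x)) h0
    have habs : ∀ t : ℝ, |α⁻¹ * t| = |t| / α := fun t => by
      rw [abs_mul, abs_of_pos (inv_pos.mpr hα), mul_comm, div_eq_mul_inv]
    have hread : readFst (i, e) (columnVec N c) = if e = c then 1 else 0 := rfl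
    rw [hread]
    by_cases he : e = c
    · subst he
      have h2 : chainTermSnd e (α⁻¹ * readSnd (i, e) x) (α⁻¹ * readFst (i, e) x) ≤ -1 := by
        refine chainTermSnd_le ?_ ?_
        · rw [habs, div_le_one hα]
          exact hc _
        · by_cases he : (e : ℕ) = 0
          · exact Or.inl he
          · right
            rw [habs, one_le_div hα, readSnd_apply, if_neg he]
            exact hp.resolve_left he _
      simp only [if_true, mul_one]
      linarith
    · simp only [he, if_false, mul_zero, add_zero]
      exact h1
  refine (Finset.sum_le_sum fun r _ => hterm r).trans (le_of_eq ?_)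
  simp [Fintype.sum_prod_type]

lemma exists_hardFDeriv_columnVec_le (hl : 0 < l₀) (hL : 0 < L) (hα : 0 < α) (hN : 0 < N)
    {x : EuclideanSpace ℝ (Fin (2 * N) × Fin d)}
    (hx : x ∈ (Matrix.toEuclideanLin (hardA N d)).ker) {c₁ : Fin d}
    (hc₁ : ∀ j, x (j, c₁) = 0) :
    ∃ c, hardFDeriv l₀ L α N d x (columnVec N c) ≤ -(L * α / l₀ * N) := by
  classical
  -- The least coordinate of size at most `α`; its predecessor, if any, exceeds `α`. It exists
  -- because of the zero coordinate `c₁`.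
  let Q : ℕ → Prop := fun n => ∃ h : n < d, |x (⟨0, by omega⟩, ⟨n, h⟩)| ≤ α
  have hQ : ∃ n, Q n := ⟨c₁, c₁.2, by
    rw [hc₁, abs_zero]
    exact hα.le⟩
  obtain ⟨hlt, hle⟩ := Nat.find_spec hQ
  refine ⟨⟨Nat.find hQ, hlt⟩, hardFDeriv_columnVec_le hl hL hα (fun j => ?_) ?_⟩
  · rw [apply_eq_of_mem_ker hx hN]
    exact hle
  · by_cases h0 : Nat.find hQ = 0
    · exact Or.inl h0
    · refine Or.inr fun j => ?_
      rw [apply_eq_of_mem_ker hx hN]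
      have := Nat.find_min hQ (m := Nat.find hQ - 1) (by omega)
      by_contra hcon
      exact this ⟨by omega, (not_le.mp hcon).le⟩

/-- Let `p` be the proximal point and `z` the projection of `x` onto `ker A`. For `w` in `ker A`,
optimality of `p` gives `⟨∇f(x), w⟩ = 2L ⟨x - p, w⟩`, and replacing `∇f(x)` by `∇f(z)` costs at most
`L ‖x - p‖ ‖w‖`. The total factor `3` is squared and multiplied by `‖w‖² = 2N`, whence `18`. -/
lemma le_subOptNC_sq (hl : 0 < l₀) (hL : 0 < L) (hα : 0 < α) (hN : 0 < N)
    (hsmooth : IsSmoothWith L (hardF l₀ L α N d))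
    {x : EuclideanSpace ℝ (Fin (2 * N) × Fin d)} {c₁ : Fin d} (hc₁ : ∀ j, x (j, c₁) = 0) :
    L ^ 2 * α ^ 2 / l₀ ^ 2 * N ≤ 18 * (hardProblem l₀ L α N d).subOptNC L x ^ 2 := by
  rw [subOptNC_hardProblem hL]
  set K := (Matrix.toEuclideanLin (hardA N d)).ker with hK
  set f := hardF l₀ L α N d with hf
  set y := x - (1 / (2 * L)) • ∇ f x with hy
  obtain ⟨hpK, hpo⟩ := (isProxPoint_setIndicator_prox K y).mem_and_inner_eq_zero
  set p := prox (setIndicator (K : Set _)) y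
  set z := K.starProjection x with hz
  have hzK : z ∈ K := K.starProjection_apply_mem x
  have hzo : ∀ w ∈ K, inner ℝ (x - z) w = 0 := fun w hw =>
    K.starProjection_inner_eq_zero x w hw
  have hdist : ‖x - z‖ ≤ ‖x - p‖ := by
    rw [K.starProjection_minimal]
    exact ciInf_le (f := fun w : K => ‖x - w‖)
      ⟨0, by rintro _ ⟨w, rfl⟩; exact norm_nonneg _⟩ ⟨p, hpK⟩
  -- Projection onto the consensus space averages the blocks, so a coordinate zero in every block
  -- stays zero.
  have hz0 : ∀ j, z (j, c₁) = 0 := by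
    intro j
    have h := hzo _ (columnVec_mem_ker (N := N) c₁)
    rw [inner_columnVec] at h
    have e : ∀ i, (x - z) (i, c₁) = -z (j, c₁) := fun i => by
      rw [PiLp.sub_apply, hc₁, zero_sub, apply_eq_of_mem_ker hzK hN i, apply_eq_of_mem_ker hzK hN j]
    simp only [e, Finset.sum_const, Finset.card_univ, Fintype.card_fin, nsmul_eq_mul] at h
    have hN' : ((2 * N : ℕ) : ℝ) ≠ 0 := by positivity
    exact neg_eq_zero.mp ((mul_eq_zero.mp h).resolve_left hN')
  obtain ⟨c, hc⟩ := exists_hardFDeriv_columnVec_le hl hL hα hN hzK hz0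
  set w := columnVec N c with hw
  have hwK : w ∈ K := columnVec_mem_ker c
  rw [← inner_gradient_eq (hasFDerivAt_hardF l₀ L α z)] at hc
  have h1 : inner ℝ (∇ f x) w = 2 * L * inner ℝ (x - p) w := by
    have h := hpo w hwK
    rw [show y - p = (x - p) - (1 / (2 * L)) • ∇ f x by rw [hy]; abel, inner_sub_left,
      real_inner_smul_left] at h
    rw [sub_eq_zero.mp h]
    field_simp
  have h2 : |inner ℝ (x - p) w| ≤ ‖x - p‖ * ‖w‖ := abs_real_inner_le_norm _ _
  have h3 : |inner ℝ (∇ f x - ∇ f z) w| ≤ L * ‖x - p‖ * ‖w‖ :=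
    (abs_real_inner_le_norm _ _).trans (mul_le_mul_of_nonneg_right
      ((hsmooth.2 x z).trans (mul_le_mul_of_nonneg_left hdist hL.le)) (norm_nonneg _))
  rw [inner_sub_left] at h3
  have h4 : L * α / l₀ * N ≤ 3 * (L * ‖x - p‖) * ‖w‖ := by
    have a := abs_le.mp h2
    have b := abs_le.mp h3
    nlinarith
  have h5 := pow_le_pow_left₀ (by positivity) h4 2
  rw [mul_pow _ ‖w‖, norm_columnVec_sq] at h5
  have hN' : (0 : ℝ) < N := by positivity
  refine le_of_mul_le_mul_right ?_ hN'
  calc L ^ 2 * α ^ 2 / l₀ ^ 2 * N * N = (L * α / l₀ * N) ^ 2 := by ring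
    _ ≤ _ := h5
    _ = _ := by ring

end Problem

/-! ### Choice of `N`, `d`, `α` and the final constants. -/

lemma hardN_pos {κ : ℝ} (hκ : 1 ≤ κ) : 0 < hardN κ :=
  Nat.floor_pos.mpr (by linarith)

lemma two_mul_hardN_sub_one_le {κ : ℝ} (hκ : 1 ≤ κ) : 2 * (hardN κ : ℝ) - 1 ≤ κ := by
  have := Nat.floor_le (a := (κ + 1) / 2) (by linarith)
  unfold hardN
  linarith

lemma lt_two_mul_hardN_add_one (κ : ℝ) : κ < 2 * ((hardN κ : ℝ) + 1) := by
  have := Nat.lt_floor_add_one ((κ + 1) / 2)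
  unfold hardN
  linarith

lemma hardK_nonneg {κ : ℝ} (hκ : 1 ≤ κ) {k : ℕ} (hk : κ ≤ k) : 0 ≤ hardK κ k := by
  have hN : (1 : ℝ) ≤ hardN κ := by exact_mod_cast hardN_pos hκ
  have h : (-1 : ℤ) ≤ ⌊((k : ℝ) - 2) / ((hardN κ : ℝ) + 1)⌋ := by
    rw [Int.le_floor, le_div_iff₀ (by linarith)]
    push_cast
    linarith
  unfold hardK
  omega

lemma cast_hardDim {κ : ℝ} (hκ : 1 ≤ κ) {k : ℕ} (hk : κ ≤ k) :
    ((hardDim κ k : ℕ) : ℤ) = hardK κ k + 2 :=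
  Int.toNat_of_nonneg (by linarith [hardK_nonneg hκ hk])

/-- Since `N + 1 > κ / 2`, the dimension is at most `2k/κ + 3`, and `k ≥ κ` absorbs the `3`. -/
lemma hardDim_le {κ : ℝ} (hκ : 1 ≤ κ) {k : ℕ} (hk : κ ≤ k) :
    (hardDim κ k : ℝ) ≤ 5 * k / κ := by
  have h1 : (hardDim κ k : ℝ) = hardK κ k + 2 := by exact_mod_cast cast_hardDim hκ hk
  have h2 : (hardK κ k : ℝ) ≤ ((k : ℝ) - 2) / ((hardN κ : ℝ) + 1) + 1 := by
    unfold hardK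
    push_cast
    linarith [Int.floor_le (((k : ℝ) - 2) / ((hardN κ : ℝ) + 1))]
  have hN := lt_two_mul_hardN_add_one κ
  have h3 : ((k : ℝ) - 2) / ((hardN κ : ℝ) + 1) ≤ 2 * k / κ := by
    rw [div_le_div_iff₀ (by linarith) (by linarith)]
    nlinarith
  have h4 : 1 ≤ (k : ℝ) / κ := (one_le_div (by linarith)).mpr hk
  rw [h1]
  calc (hardK κ k : ℝ) + 2 ≤ 2 * k / κ + 3 * (k / κ) := by linarith
    _ = 5 * k / κ := by ring

lemma unreached_last {κ : ℝ} (hκ : 1 ≤ κ) {k : ℕ} (hk : κ ≤ k) (j : ℕ) :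
    Unreached (hardN κ) k j (hardDim κ k - 1) := by
  right
  have h1 : ((k : ℝ) - 2) / ((hardN κ : ℝ) + 1) < hardK κ k := by
    unfold hardK
    push_cast
    exact Int.lt_floor_add_one _
  rw [div_lt_iff₀ (by positivity)] at h1
  have h2 : (k : ℤ) - 2 < hardK κ k * ((hardN κ : ℤ) + 1) := by exact_mod_cast h1
  have hd := cast_hardDim hκ hk
  have hK := hardK_nonneg hκ hk
  have hd1 : ((hardDim κ k - 1 : ℕ) : ℤ) = hardK κ k + 1 := by omega
  zify
  rw [hd1]
  linarith

lemma subOptNC_nonneg {m n : Type*} [Fintype m] [Fintype n] [DecidableEq n]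
    (P : CompositeProblem m n) {L : ℝ} (hL : 0 ≤ L) (x : EuclideanSpace ℝ n) :
    0 ≤ P.subOptNC L x :=
  mul_nonneg hL (norm_nonneg _)

/-- The instance is tuned to `k` but the bound covers every `i ≤ k`, since supports only grow. -/
lemma hardProblem_lower_bound {C L Δ κ : ℝ} (hC : 0 < C)
    (h : ∀ c, IsPlaneLipschitz C (chainTermFst c) ∧ IsPlaneLipschitz C (chainTermSnd c))
    (hL : 0 < L) (hΔ : 0 < Δ) (hκ : 1 ≤ κ) {k : ℕ} (hk : κ ≤ k) :
    0 < hardDim κ k ∧ 0 < hardScale (2 * C) L Δ κ k ∧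
    (hardProblem (2 * C) L (hardScale (2 * C) L Δ κ k) (hardN κ)
      (hardDim κ k)).InClassNC L Δ κ 0 ∧
    ∀ x lam, (hardProblem (2 * C) L (hardScale (2 * C) L Δ κ k) (hardN κ)
        (hardDim κ k)).IsFirstOrderLinearSpan x lam → x 0 = 0 → lam 0 = 0 → ∀ i ≤ k,
      κ * L * Δ / (1080 * (2 * C) * k) ≤ (hardProblem (2 * C) L (hardScale (2 * C) L Δ κ k)
        (hardN κ) (hardDim κ k)).subOptNC L (x i) ^ 2 := by
  have hN := hardN_pos hκ
  have hdim := cast_hardDim hκ hk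
  have hK := hardK_nonneg hκ hk
  have hd : 0 < hardDim κ k := by omega
  have hN' : (0 : ℝ) < hardN κ := by exact_mod_cast hN
  have hd' : (0 : ℝ) < hardDim κ k := by exact_mod_cast hd
  have hsq : hardScale (2 * C) L Δ κ k ^ 2 =
      2 * C * Δ / (12 * hardN κ * hardDim κ k * L) := Real.sq_sqrt (by positivity)
  have hα : 0 < hardScale (2 * C) L Δ κ k := Real.sqrt_pos.mpr (by positivity)
  have hle := hardDim_le hκ hk
  have hunr : ∀ j, Unreached (hardN κ) k j (hardDim κ k - 1) := unreached_last hκ hk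
  generalize hardScale (2 * C) L Δ κ k = α at *
  generalize hardDim κ k = d at *
  have hclass := inClassNC_hardProblem (d := d) hC h hL hα hN hd (two_mul_hardN_sub_one_le hκ)
    (Δ := Δ) (by
      rw [hsq]
      refine le_of_eq ?_
      field_simp)
  refine ⟨hd, hα, hclass, fun x lam hrun hx hl i hi => ?_⟩
  have hmem := primalReach_mono hi (iterate_mem_primalReach hα.ne' hrun hx hl i)
  have hsub := le_subOptNC_sq (by positivity) hL hα hN hclass.smooth (c₁ := ⟨d - 1, by omega⟩)
    (x := x i) fun j => hmem j _ (hunr j)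
  rw [hsq] at hsub
  have hk' : (0 : ℝ) < k := by linarith
  -- `N` cancels; `216 = 12 · 18`, and `d ≤ 5k/κ` then yields `1080`.
  have e : L ^ 2 * (2 * C * Δ / (12 * hardN κ * d * L)) / (2 * C) ^ 2 * hardN κ =
      18 * (L * Δ / (216 * (2 * C) * d)) := by
    field_simp
    norm_num
  rw [e] at hsub
  refine le_trans ?_ (le_of_mul_le_mul_left hsub (by norm_num))
  rw [le_div_iff₀ (by linarith)] at hle
  rw [div_le_div_iff₀ (by positivity) (by positivity)]
  have := mul_le_mul_of_nonneg_left hle (show 0 ≤ 216 * (2 * C) * (L * Δ) by positivity)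
  linarith

end

theorem mainTheorem5 :
    ∃ l₀ c₀ c₁ : ℝ, 0 < l₀ ∧ 0 < c₀ ∧ 0 < c₁ ∧
      (∀ d : ℕ, IsSmoothWith l₀
        (fun p : WithLp 2 (EuclideanSpace ℝ (Fin d) × EuclideanSpace ℝ (Fin d)) =>
          chainG₀ d p.fst p.snd)) ∧
      (∀ L Δ κ : ℝ, 0 < L → 0 < Δ → 1 ≤ κ → ∀ k : ℕ, κ ≤ k →
        (hardProblem l₀ L (hardScale l₀ L Δ κ k) (hardN κ) (hardDim κ k)).InClassNC L Δ κ 0 ∧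
        ∀ x lam,
          (hardProblem l₀ L (hardScale l₀ L Δ κ k) (hardN κ)
            (hardDim κ k)).IsFirstOrderLinearSpan x lam →
          x 0 = 0 → lam 0 = 0 →
          c₀ * Real.sqrt (κ * L * Δ / k) ≤
            (hardProblem l₀ L (hardScale l₀ L Δ κ k) (hardN κ) (hardDim κ k)).subOptNC L (x k)) ∧
      (∀ L Δ κ : ℝ, 0 < L → 0 < Δ → 1 ≤ κ →
        ∀ ε : ℝ, 0 < ε → ε ≤ c₀ * Real.sqrt (L * Δ) →
        ∃ (N d : ℕ) (α : ℝ), 0 < N ∧ 0 < d ∧ 0 < α ∧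
          (hardProblem l₀ L α N d).InClassNC L Δ κ 0 ∧
          ∀ x lam, (hardProblem l₀ L α N d).IsFirstOrderLinearSpan x lam →
            x 0 = 0 → lam 0 = 0 →
            ∀ k : ℕ, (hardProblem l₀ L α N d).subOptNC L (x k) ≤ ε →
              c₁ * (κ * L * Δ / ε ^ 2) ≤ k) := by
  obtain ⟨C, hC, h⟩ := exists_isPlaneLipschitz_chainTerm
  -- Part 1 only needs `2400 ≥ 1080`; part 2 needs more than `2 · 1080`, to absorb the rounding of
  -- `T`.
  have hc : 0 < 1 / (2400 * (2 * C)) := by positivity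
  refine ⟨2 * C, Real.sqrt (1 / (2400 * (2 * C))), 1 / (2400 * (2 * C)), by positivity,
    Real.sqrt_pos.mpr hc, hc, isSmoothWith_chainG₀ hC h, ?_, ?_⟩
  · intro L Δ κ hL hΔ hκ k hk
    obtain ⟨-, -, hclass, hbound⟩ := hardProblem_lower_bound hC h hL hΔ hκ hk
    refine ⟨hclass, fun x lam hrun hx hl => ?_⟩
    refine (abs_le_of_sq_le_sq' (le_trans ?_ (hbound x lam hrun hx hl k le_rfl))
      (subOptNC_nonneg _ hL.le _)).2
    have hk' : (0 : ℝ) < k := by linarith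
    rw [mul_pow, Real.sq_sqrt hc.le, Real.sq_sqrt (by positivity), div_mul_div_comm, one_mul]
    gcongr
    norm_num
  · intro L Δ κ hL hΔ hκ ε hε hεle
    -- The claimed complexity. The restriction on `ε` is what makes `T ≥ κ`, so that `⌈T⌉₊` is an
    -- admissible step count for the instance.
    set T := 1 / (2400 * (2 * C)) * (κ * L * Δ / ε ^ 2) with hT
    have hε2 : ε ^ 2 ≤ 1 / (2400 * (2 * C)) * (L * Δ) := by
      have := pow_le_pow_left₀ hε.le hεle 2
      rwa [mul_pow, Real.sq_sqrt hc.le, Real.sq_sqrt (by positivity)] at this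
    have hTκ : κ ≤ T := by
      have e : T = κ * (1 / (2400 * (2 * C)) * (L * Δ)) / ε ^ 2 := by
        rw [hT]
        ring
      rw [e, le_div_iff₀ (by positivity)]
      gcongr
    have hTk : T ≤ (⌈T⌉₊ : ℝ) := Nat.le_ceil T
    have hkT : (⌈T⌉₊ : ℝ) < T + 1 := Nat.ceil_lt_add_one (by linarith)
    obtain ⟨hd, hα, hclass, hbound⟩ := hardProblem_lower_bound hC h hL hΔ hκ (hTκ.trans hTk)
    refine ⟨_, _, _, hardN_pos hκ, hd, hα, hclass, fun x lam hrun hx hl k hsub => ?_⟩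
    by_contra hlt
    have hk : k ≤ ⌈T⌉₊ := by
      have : (k : ℝ) ≤ (⌈T⌉₊ : ℝ) := (not_le.mp hlt).le.trans hTk
      exact_mod_cast this
    have h1 := hbound x lam hrun hx hl k hk
    have h2 := pow_le_pow_left₀ (subOptNC_nonneg _ hL.le _) hsub 2
    have h3 := h1.trans h2
    have hkpos : (0 : ℝ) < (⌈T⌉₊ : ℝ) := by linarith
    rw [div_le_iff₀ (by positivity)] at h3
    have e : κ * L * Δ = 2400 * (2 * C) * ε ^ 2 * T := by
      rw [hT]
      field_simp
    rw [e] at h3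
    have hpos : 0 < 2 * C * ε ^ 2 := by positivity
    -- Contradiction: `2400 T ≤ 1080 ⌈T⌉₊ < 1080 (T + 1) ≤ 2160 T`, because `T ≥ κ ≥ 1`.
    have h4 : 2 * C * ε ^ 2 * (2400 * T) ≤ 2 * C * ε ^ 2 * (1080 * (⌈T⌉₊ : ℝ)) := by linarith
    have h5 := le_of_mul_le_mul_left h4 hpos
    linarith
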